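/- Let $\mathbb{S}^3\times\mathbb{R}$ be the Riemannian product of the unit 3-sphere and the real line, let $\partial_t$ be the unit vector field tangent to the $\mathbb{R}$-direction, and let $\theta\in(0,\pi/2)$ be a constant. Let $F\colon M\to\mathbb{S}^3\times\mathbb{R}$ be a smooth immersion of a smooth surface $M$ (a 2-dimensional manifold without boundary) such that at every point of $M$ the vector $\partial_t$ makes the angle $\theta$ with the normal plane of $M$ in $\mathbb{S}^3\times\mathbb{R}$; that is, at every point $\partial_t=\sin\theta\,T+\cos\theta\,\xi$ with a unit tangent vector $T$ and a unit normal vector $\xi$ of $M$. If the mean curvature vector field $\vec H$ of $M$ is parallel with respect to the normal connection, $\nabla^{\perp}\vec H=0$, then $\vec H=0$ on $M$, that is, $M$ is a minimal surface in $\mathbb{S}^3\times\mathbb{R}$. -/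

import Mathlib

open Metric
open scoped Manifold ContDiff RealInnerProductSpace

noncomputable section

namespace S3R

/-- The Riemannian product manifold `S³(1) × ℝ`: the unit sphere of Euclidean `ℝ⁴` times the real
line, with the product smooth structure. Its metric is the one induced by the embedding `incl`. -/
abbrev Space : Type := sphere (0 : EuclideanSpace ℝ (Fin 4)) 1 × ℝ

/-- Euclidean 5-space, as the orthogonal sum of `ℝ⁴` and `ℝ`. -/
abbrev E5 : Type := WithLp 2 (EuclideanSpace ℝ (Fin 4) × ℝ)

/-- The standard isometric embedding of `S³ × ℝ` in Euclidean 5-space. -/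
def incl (q : Space) : E5 := WithLp.toLp 2 ((q.1 : EuclideanSpace ℝ (Fin 4)), q.2)

/-- The tangent space of `S³ × ℝ` at `q`, as a subspace of Euclidean 5-space: the orthogonal
complement of the normal vector `(q.1, 0)`. -/
def ambientTangent (q : Space) : Submodule ℝ E5 :=
  (ℝ ∙ (WithLp.toLp 2 ((q.1 : EuclideanSpace ℝ (Fin 4)), (0 : ℝ)) : E5))ᗮ

/-- The unit vector field `∂t` tangent to the `ℝ`-direction. -/
def dt : E5 := WithLp.toLp 2 ((0 : EuclideanSpace ℝ (Fin 4)), (1 : ℝ))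

variable {M : Type*} [TopologicalSpace M] [ChartedSpace (EuclideanSpace ℝ (Fin 2)) M]

/-- A smooth immersion of the surface `M` in `S³ × ℝ`. -/
structure IsSmoothImmersion (F : M → Space) : Prop where
  contMDiff : ContMDiff (𝓡 2) ((𝓡 3).prod 𝓘(ℝ, ℝ)) ∞ F
  injective_mfderiv : ∀ p : M,
    Function.Injective (mfderiv (𝓡 2) ((𝓡 3).prod 𝓘(ℝ, ℝ)) F p)

/-- The differential at `p` of a map `V : M → E5` (the immersion, or a vector field along it). -/
def diff (V : M → E5) (p : M) : EuclideanSpace ℝ (Fin 2) →L[ℝ] E5 :=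
  mfderiv (𝓡 2) 𝓘(ℝ, E5) V p

/-- The tangent plane `dF (T_p M)` of the surface. -/
def tangentPlane (F : M → Space) (p : M) : Submodule ℝ E5 :=
  LinearMap.range (diff (fun q => incl (F q)) p).toLinearMap

/-- The normal plane of the surface in `S³ × ℝ` at `p`. -/
def normalPlane (F : M → Space) (p : M) : Submodule ℝ E5 :=
  ambientTangent (F p) ⊓ (tangentPlane F p)ᗮ

/-- At `p`, the direction `∂t` makes the angle `θ` with the normal plane:
`∂t = sin θ T + cos θ ξ` with a unit tangent vector `T` and a unit normal vector `ξ`. -/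
def HasAngleAt (F : M → Space) (θ : ℝ) (p : M) : Prop :=
  ∃ T ∈ tangentPlane F p, ∃ ξ ∈ normalPlane F p,
    ‖T‖ = 1 ∧ ‖ξ‖ = 1 ∧ dt = Real.sin θ • T + Real.cos θ • ξ

/-- The Levi-Civita connection of `S³ × ℝ` along `F`: the covariant derivative at `p`, in the
direction `u ∈ T_p M`, of a vector field `V` along `F`. It is the tangential part of the
derivative in Euclidean 5-space. -/
def ambientCov (F : M → Space) (V : M → E5) (p : M) (u : EuclideanSpace ℝ (Fin 2)) : E5 :=
  (ambientTangent (F p)).starProjection (diff V p u)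

/-- For a normal vector field `V` of the surface, the derivative of `V` at `p` in the direction `u`
with respect to the normal connection. -/
def normalCov (F : M → Space) (V : M → E5) (p : M) (u : EuclideanSpace ℝ (Fin 2)) : E5 :=
  (normalPlane F p).starProjection (ambientCov F V p u)

/-- The vector field along `F`, defined near `p`, which is the image under `dF` of the coordinate
vector field with constant components `v` in the preferred chart at `p`. -/
def coordField (F : M → Space) (p : M) (v : EuclideanSpace ℝ (Fin 2)) (q : M) : E5 :=
  fderiv ℝ (fun y => incl (F ((extChartAt (𝓡 2) p).symm y))) (extChartAt (𝓡 2) p q) v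

/-- The second fundamental form of the surface at `p` (Gauss formula): the normal part of
the ambient covariant derivative in the direction `u` of an extension of `v`. The value does not
depend on the extension. -/
def secondFundamentalForm (F : M → Space) (p : M) (u v : EuclideanSpace ℝ (Fin 2)) : E5 :=
  (normalPlane F p).starProjection (ambientCov F (coordField F p v) p u)

/-- The Gram matrix at `p` of the induced metric in the standard basis of `T_p M`. -/
def gram (F : M → Space) (p : M) : Matrix (Fin 2) (Fin 2) ℝ := Matrix.of fun i j =>
  ⟪diff (fun q => incl (F q)) p (EuclideanSpace.single i (1 : ℝ)),
    diff (fun q => incl (F q)) p (EuclideanSpace.single j (1 : ℝ))⟫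

/-- The mean curvature vector: half of the trace of the second fundamental form with respect to
the induced metric. -/
def meanCurvature (F : M → Space) (p : M) : E5 :=
  (1 / 2 : ℝ) • ∑ i, ∑ j, (gram F p)⁻¹ i j •
    secondFundamentalForm F p (EuclideanSpace.single i (1 : ℝ)) (EuclideanSpace.single j (1 : ℝ))

/-- The mean curvature vector field is parallel with respect to the normal connection. -/
def HasParallelMeanCurvature (F : M → Space) : Prop :=
  ∀ (p : M) (u : EuclideanSpace ℝ (Fin 2)), normalCov F (meanCurvature F) p u = 0

end S3R

end

/-
The axis `k = ∂t` splits as `σ T + c ξ` with `σ = sin θ`, `c = cos θ`, and the surface has a local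
adapted frame: `T`, the tangent field `S ⊥ T`, `ξ`, and a second normal field `η`. Its second
fundamental form has `⟪ξ, II⟫` proportional to `S ⊗ S` and is therefore given by functions
`l, a, b, m`. Parallelism of the mean curvature expresses the derivatives of `l` and `m` through
`a` and `b`; together with the Codazzi equations, the commutator `[T, S]` applied to `m` gives
`l² b = 0`. Where `l ≠ 0` this forces `b = 0`, then `m = c a`, whose derivative along `T`
contradicts the equation for `m`. So `l = 0`, and then `m a = m b = 0` while the Gauss equation
becomes `a² + b² = 1`, so `m = 0`.
-/

noncomputable section

open VectorField

section DirectionalDerivative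

variable {V G : Type*} [NormedAddCommGroup V] [NormedSpace ℝ V]
  [NormedAddCommGroup G] [NormedSpace ℝ G] {X Y : V → V} {g h : V → G} {y : V} {U : Set V}

/-- The derivative of the function `g` along the vector field `X`. -/
def dirDeriv (X : V → V) (g : V → G) (y : V) : G := fderiv ℝ g y (X y)

theorem contDiffOn_dirDeriv (hU : IsOpen U) (hX : ContDiffOn ℝ ∞ X U) (hg : ContDiffOn ℝ ∞ g U) :
    ContDiffOn ℝ ∞ (dirDeriv X g) U :=
  (hg.fderiv_of_isOpen hU (by simp)).clm_apply hX

theorem differentiableAt_of_contDiffOn (hU : IsOpen U) (hg : ContDiffOn ℝ ∞ g U) (hy : y ∈ U) :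
    DifferentiableAt ℝ g y :=
  (hg.contDiffAt (hU.mem_nhds hy)).differentiableAt (by simp)

theorem dirDeriv_congr (hU : IsOpen U) (hgh : U.EqOn g h) (hy : y ∈ U) :
    dirDeriv X g y = dirDeriv X h y := by
  simp only [dirDeriv, (hgh.eventuallyEq_of_mem (hU.mem_nhds hy)).fderiv_eq]

theorem dirDeriv_eq_zero_of_eqOn_const (hU : IsOpen U) {v : G} (hg : ∀ z ∈ U, g z = v)
    (hy : y ∈ U) : dirDeriv X g y = 0 := by
  rw [dirDeriv_congr (h := fun _ => v) hU hg hy]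
  simp [dirDeriv]

theorem dirDeriv_add (hg : DifferentiableAt ℝ g y) (hh : DifferentiableAt ℝ h y) :
    dirDeriv X (fun z => g z + h z) y = dirDeriv X g y + dirDeriv X h y := by
  rw [dirDeriv, fderiv_fun_add hg hh]; rfl

theorem dirDeriv_const_smul (r : ℝ) (hg : DifferentiableAt ℝ g y) :
    dirDeriv X (fun z => r • g z) y = r • dirDeriv X g y := by
  rw [dirDeriv, fderiv_fun_const_smul hg]; rfl

theorem dirDeriv_mul {p q : V → ℝ} (hp : DifferentiableAt ℝ p y) (hq : DifferentiableAt ℝ q y) :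
    dirDeriv X (fun z => p z * q z) y = dirDeriv X p y * q y + p y * dirDeriv X q y := by
  rw [dirDeriv, fderiv_fun_mul hp hq, add_comm, mul_comm (dirDeriv X p y)]
  rfl

theorem dirDeriv_sub_dirDeriv_eq_fderiv_lieBracket (hg : ContDiffAt ℝ 2 g y)
    (hX : DifferentiableAt ℝ X y) (hY : DifferentiableAt ℝ Y y) :
    dirDeriv X (dirDeriv Y g) y - dirDeriv Y (dirDeriv X g) y =
      fderiv ℝ g y (lieBracket ℝ X Y y) :=
  (fderiv_apply_lieBracket hg (by simp) hY hX).symm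

end DirectionalDerivative

section DirectionalDerivativeInner

variable {V E : Type*} [NormedAddCommGroup V] [NormedSpace ℝ V]
  [NormedAddCommGroup E] [InnerProductSpace ℝ E] {X Y : V → V} {g h : V → E} {y : V} {U : Set V}

theorem dirDeriv_inner (hg : DifferentiableAt ℝ g y) (hh : DifferentiableAt ℝ h y) :
    dirDeriv X (fun z => ⟪g z, h z⟫) y = ⟪g y, dirDeriv X h y⟫ + ⟪dirDeriv X g y, h y⟫ :=
  fderiv_inner_apply ℝ hg hh (X y)

theorem inner_dirDeriv_eq_neg_of_inner_eq_const (hU : IsOpen U) (hg : ContDiffOn ℝ ∞ g U)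
    (hh : ContDiffOn ℝ ∞ h U) {r : ℝ} (hr : ∀ z ∈ U, ⟪g z, h z⟫ = r) (hy : y ∈ U) :
    ⟪g y, dirDeriv X h y⟫ = -⟪h y, dirDeriv X g y⟫ := by
  have hconst := dirDeriv_eq_zero_of_eqOn_const (X := X) hU hr hy
  rw [dirDeriv_inner (differentiableAt_of_contDiffOn hU hg hy)
    (differentiableAt_of_contDiffOn hU hh hy), real_inner_comm (h y)] at hconst
  exact eq_neg_of_add_eq_zero_left hconst

theorem dirDeriv_inner_dirDeriv_sub (hg : DifferentiableAt ℝ g y) (hh : ContDiffAt ℝ 2 h y)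
    (hX : DifferentiableAt ℝ X y) (hY : DifferentiableAt ℝ Y y) :
    dirDeriv X (fun z => ⟪g z, dirDeriv Y h z⟫) y -
        dirDeriv Y (fun z => ⟪g z, dirDeriv X h z⟫) y =
      ⟪dirDeriv X g y, dirDeriv Y h y⟫ - ⟪dirDeriv Y g y, dirDeriv X h y⟫ +
        ⟪g y, fderiv ℝ h y (lieBracket ℝ X Y y)⟫ := by
  have hh' : DifferentiableAt ℝ (fderiv ℝ h) y :=
    (hh.fderiv_right (m := 1) one_add_one_eq_two.le).differentiableAt one_ne_zero
  have hXh : DifferentiableAt ℝ (dirDeriv X h) y := hh'.clm_apply hX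
  have hYh : DifferentiableAt ℝ (dirDeriv Y h) y := hh'.clm_apply hY
  rw [dirDeriv_inner hg hYh, dirDeriv_inner hg hXh,
    ← dirDeriv_sub_dirDeriv_eq_fderiv_lieBracket hh hX hY, inner_sub_right]
  ring

end DirectionalDerivativeInner

section GaussCodazziSystem

variable {V : Type*} [NormedAddCommGroup V] [NormedSpace ℝ V]

/-- The integrability conditions of a constant angle surface with parallel mean curvature, in
terms of its adapted frame: `t, s` are the tangent fields, `a, b, l` are, up to constant factors,
entries of the second fundamental form, and `σ l`, `m` are the components of twice the mean
curvature vector. -/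
structure IsGaussCodazziSystem (σ c : ℝ) (t s : V → V) (a b l m : V → ℝ) (U : Set V) : Prop where
  isOpen : IsOpen U
  contDiffOn_t : ContDiffOn ℝ ∞ t U
  contDiffOn_s : ContDiffOn ℝ ∞ s U
  contDiffOn_a : ContDiffOn ℝ ∞ a U
  contDiffOn_b : ContDiffOn ℝ ∞ b U
  contDiffOn_l : ContDiffOn ℝ ∞ l U
  contDiffOn_m : ContDiffOn ℝ ∞ m U
  lieBracket : ∀ y ∈ U, lieBracket ℝ t s y = -(c * l y) • s y
  dirDeriv_t_l : ∀ y ∈ U, dirDeriv t l y = -(m y * a y)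
  dirDeriv_s_l : ∀ y ∈ U, dirDeriv s l y = -(m y * b y)
  dirDeriv_t_m : ∀ y ∈ U, dirDeriv t m y = σ ^ 2 * (l y * a y)
  dirDeriv_s_m : ∀ y ∈ U, dirDeriv s m y = σ ^ 2 * (l y * b y)
  dirDeriv_t_b_sub : ∀ y ∈ U, dirDeriv t b y - dirDeriv s a y = -(2 * c * l y * b y)
  dirDeriv_t_a_add : ∀ y ∈ U, dirDeriv t a y + dirDeriv s b y = l y * m y - 2 * c * l y * a y
  gauss : ∀ y ∈ U, a y ^ 2 + b y ^ 2 = 1 + l y ^ 2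

namespace IsGaussCodazziSystem

variable {σ c : ℝ} {t s : V → V} {a b l m : V → ℝ} {U : Set V} {y : V}

theorem l_eq_zero_or_b_eq_zero (h : IsGaussCodazziSystem σ c t s a b l m U) (hσ : σ ≠ 0)
    (hc : c ≠ 0) (hy : y ∈ U) : l y = 0 ∨ b y = 0 := by
  have hU := h.isOpen
  have hl := differentiableAt_of_contDiffOn hU h.contDiffOn_l hy
  have ha := differentiableAt_of_contDiffOn hU h.contDiffOn_a hy
  have hb := differentiableAt_of_contDiffOn hU h.contDiffOn_b hy
  have hts : dirDeriv t (dirDeriv s m) y = σ ^ 2 * (-(m y * a y) * b y + l y * dirDeriv t b y) := by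
    rw [dirDeriv_congr hU h.dirDeriv_s_m hy]
    refine (dirDeriv_const_smul _ (hl.fun_mul hb)).trans ?_
    rw [dirDeriv_mul hl hb, h.dirDeriv_t_l y hy, smul_eq_mul]
  have hst : dirDeriv s (dirDeriv t m) y = σ ^ 2 * (-(m y * b y) * a y + l y * dirDeriv s a y) := by
    rw [dirDeriv_congr hU h.dirDeriv_t_m hy]
    refine (dirDeriv_const_smul _ (hl.fun_mul ha)).trans ?_
    rw [dirDeriv_mul hl ha, h.dirDeriv_s_l y hy, smul_eq_mul]
  have hbracket : dirDeriv t (dirDeriv s m) y - dirDeriv s (dirDeriv t m) y =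
      -(c * l y) * (σ ^ 2 * (l y * b y)) := by
    rw [dirDeriv_sub_dirDeriv_eq_fderiv_lieBracket
      ((h.contDiffOn_m.contDiffAt (hU.mem_nhds hy)).of_le ENat.LEInfty.out)
      (differentiableAt_of_contDiffOn hU h.contDiffOn_t hy)
      (differentiableAt_of_contDiffOn hU h.contDiffOn_s hy), h.lieBracket y hy, map_smul,
      ← h.dirDeriv_s_m y hy, smul_eq_mul, dirDeriv]
  have : (σ ^ 2 * c) * (l y ^ 2 * b y) = 0 := by
    linear_combination -hbracket + hts - hst + σ ^ 2 * l y * h.dirDeriv_t_b_sub y hy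
  simpa [hσ, hc] using this

theorem isOpen_inter_ne_zero (h : IsGaussCodazziSystem σ c t s a b l m U) :
    IsOpen (U ∩ {z | l z ≠ 0}) :=
  h.contDiffOn_l.continuousOn.isOpen_inter_preimage h.isOpen isOpen_ne

theorem b_eq_zero_of_ne_zero (h : IsGaussCodazziSystem σ c t s a b l m U) (hσ : σ ≠ 0)
    (hc : c ≠ 0) (hy : y ∈ U ∩ {z | l z ≠ 0}) : b y = 0 :=
  (h.l_eq_zero_or_b_eq_zero hσ hc hy.1).resolve_left hy.2

theorem a_ne_zero_of_ne_zero (h : IsGaussCodazziSystem σ c t s a b l m U) (hσ : σ ≠ 0)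
    (hc : c ≠ 0) (hy : y ∈ U ∩ {z | l z ≠ 0}) : a y ≠ 0 := by
  intro ha
  have hgauss := h.gauss y hy.1
  rw [ha, h.b_eq_zero_of_ne_zero hσ hc hy] at hgauss
  nlinarith [sq_nonneg (l y)]

theorem dirDeriv_t_a_of_ne_zero (h : IsGaussCodazziSystem σ c t s a b l m U) (hσ : σ ≠ 0)
    (hc : c ≠ 0) (hy : y ∈ U ∩ {z | l z ≠ 0}) : dirDeriv t a y = -(l y * m y) := by
  have ha := differentiableAt_of_contDiffOn h.isOpen h.contDiffOn_a hy.1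
  have hl := differentiableAt_of_contDiffOn h.isOpen h.contDiffOn_l hy.1
  have hgauss : ∀ z ∈ U ∩ {z | l z ≠ 0}, a z * a z + (-1 : ℝ) • (l z * l z) = 1 := by
    intro z hz
    have hz' := h.gauss z hz.1
    rw [h.b_eq_zero_of_ne_zero hσ hc hz] at hz'
    linear_combination hz'
  have hderiv := dirDeriv_eq_zero_of_eqOn_const (X := t) h.isOpen_inter_ne_zero hgauss hy
  rw [dirDeriv_add (ha.fun_mul ha) ((hl.fun_mul hl).fun_const_smul _),
    dirDeriv_const_smul _ (hl.fun_mul hl), dirDeriv_mul ha ha, dirDeriv_mul hl hl,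
    h.dirDeriv_t_l y hy.1, smul_eq_mul] at hderiv
  refine mul_left_cancel₀ (h.a_ne_zero_of_ne_zero hσ hc hy) ?_
  linear_combination hderiv / 2

theorem m_eq_of_ne_zero (h : IsGaussCodazziSystem σ c t s a b l m U) (hσ : σ ≠ 0)
    (hc : c ≠ 0) (hy : y ∈ U ∩ {z | l z ≠ 0}) : m y = c • a y := by
  have htrace := h.dirDeriv_t_a_add y hy.1
  rw [h.dirDeriv_t_a_of_ne_zero hσ hc hy, dirDeriv_eq_zero_of_eqOn_const h.isOpen_inter_ne_zero
    (fun _ hz => h.b_eq_zero_of_ne_zero hσ hc hz) hy] at htrace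
  refine mul_left_cancel₀ hy.2 ?_
  rw [smul_eq_mul]
  linear_combination -htrace / 2

theorem l_eq_zero (h : IsGaussCodazziSystem σ c t s a b l m U) (hσ : σ ≠ 0) (hc : c ≠ 0)
    (hy : y ∈ U) : l y = 0 := by
  by_contra hly
  have hy' : y ∈ U ∩ {z | l z ≠ 0} := ⟨hy, hly⟩
  have hm := dirDeriv_congr (X := t) h.isOpen_inter_ne_zero
    (fun _ hz => h.m_eq_of_ne_zero hσ hc hz) hy'
  rw [dirDeriv_const_smul _ (differentiableAt_of_contDiffOn h.isOpen h.contDiffOn_a hy),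
    h.dirDeriv_t_m y hy, h.dirDeriv_t_a_of_ne_zero hσ hc hy', h.m_eq_of_ne_zero hσ hc hy',
    smul_eq_mul, smul_eq_mul] at hm
  have hprod : (σ ^ 2 + c ^ 2) * (l y * a y) = 0 := by linear_combination hm
  exact mul_ne_zero (by positivity) (mul_ne_zero hly (h.a_ne_zero_of_ne_zero hσ hc hy')) hprod

theorem m_eq_zero (h : IsGaussCodazziSystem σ c t s a b l m U) (hσ : σ ≠ 0) (hc : c ≠ 0)
    (hy : y ∈ U) : m y = 0 := by
  have hl : ∀ z ∈ U, l z = 0 := fun z hz => h.l_eq_zero hσ hc hz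
  have hma := h.dirDeriv_t_l y hy
  have hmb := h.dirDeriv_s_l y hy
  rw [dirDeriv_eq_zero_of_eqOn_const h.isOpen hl hy] at hma hmb
  have hgauss := h.gauss y hy
  rw [hl y hy] at hgauss
  linear_combination -(m y) * hgauss + a y * hma + b y * hmb

end IsGaussCodazziSystem

end GaussCodazziSystem

section SmoothFrames

variable {V F E : Type*} [NormedAddCommGroup V] [NormedSpace ℝ V]
  [NormedAddCommGroup F] [NormedSpace ℝ F] [NormedAddCommGroup E] [InnerProductSpace ℝ E]

theorem sum_inner_map_smul_eq_self [FiniteDimensional ℝ F] {ι : Type*} [Fintype ι] (A : F →L[ℝ] E)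
    {v : ι → F} (hv : Orthonormal ℝ fun i => A (v i))
    (hcard : Fintype.card ι = Module.finrank ℝ F) (x : F) : ∑ i, ⟪A (v i), A x⟫ • v i = x := by
  have hli : LinearIndependent ℝ v := .of_comp A.toLinearMap hv.linearIndependent
  obtain ⟨r, rfl⟩ := (Submodule.mem_span_range_iff_exists_fun ℝ).1
    (hli.span_eq_top_of_card_eq_finrank' hcard ▸ Submodule.mem_top (x := x))
  simp_rw [map_sum, map_smul, hv.inner_right_fintype]

theorem exists_contDiffOn_orthonormal_vecCons {n : ℕ} {A : V → F →L[ℝ] E} {x : Fin n → V → F}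
    {U : Set V} {y : V} (hU : IsOpen U) (hy : y ∈ U) (hA : ContDiffOn ℝ ∞ A U)
    (hAy : Function.Injective (A y)) (hx : ∀ i, ContDiffOn ℝ ∞ (x i) U)
    (hon : ∀ z ∈ U, Orthonormal ℝ fun i => A z (x i z)) (hn : n < Module.finrank ℝ F) :
    ∃ U' ⊆ U, IsOpen U' ∧ y ∈ U' ∧ ∃ ν : V → F, ContDiffOn ℝ ∞ ν U' ∧
      ∀ z ∈ U', Orthonormal ℝ (Matrix.vecCons (A z (ν z)) fun i => A z (x i z)) := by
  obtain ⟨ν₀, hν₀⟩ : ∃ ν₀, ν₀ ∉ Submodule.span ℝ (Set.range fun i => x i y) := by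
    by_contra! hspan
    have hle := finrank_range_le_card (R := ℝ) fun i => x i y
    rw [Set.finrank, (Submodule.eq_top_iff').2 hspan, finrank_top, Fintype.card_fin] at hle
    omega
  let ρ : V → F := fun z => ν₀ - ∑ i, ⟪A z (x i z), A z ν₀⟫ • x i z
  have hρ : ContDiffOn ℝ ∞ ρ U := contDiffOn_const.sub <| .sum fun i _ =>
    ((hA.clm_apply (hx i)).inner ℝ (hA.clm_apply contDiffOn_const)).smul (hx i)
  have hAρ : ContDiffOn ℝ ∞ (fun z => A z (ρ z)) U := hA.clm_apply hρ
  have horth : ∀ z ∈ U, ∀ i, ⟪A z (ρ z), A z (x i z)⟫ = 0 := fun z hz i => by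
    simp_rw [ρ, map_sub, map_sum, map_smul, inner_sub_left]
    rw [(hon z hz).inner_left_fintype, conj_trivial, real_inner_comm, sub_self]
  have hρy : A y (ρ y) ≠ 0 := fun h0 => by
    have hρ0 : ρ y = 0 := hAy (h0.trans (map_zero _).symm)
    exact hν₀ (sub_eq_zero.1 hρ0 ▸ Submodule.sum_mem _ fun i _ =>
      Submodule.smul_mem _ _ (Submodule.subset_span ⟨i, rfl⟩))
  refine ⟨U ∩ {z | A z (ρ z) ≠ 0}, Set.inter_subset_left,
    hAρ.continuousOn.isOpen_inter_preimage hU isOpen_ne, ⟨hy, hρy⟩,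
    fun z => ‖A z (ρ z)‖⁻¹ • ρ z, ?_, fun z hz => orthonormal_vecCons_iff.2 ⟨?_, fun i => ?_,
      hon z hz.1⟩⟩
  · exact (((hAρ.mono Set.inter_subset_left).norm ℝ fun z hz => hz.2).inv fun z hz =>
      norm_ne_zero_iff.2 hz.2).smul (hρ.mono Set.inter_subset_left)
  · rw [map_smul, norm_smul, norm_inv, norm_norm, inv_mul_cancel₀ (norm_ne_zero_iff.2 hz.2)]
  · rw [map_smul, real_inner_smul_left, horth z hz.1 i, mul_zero]

theorem exists_contDiffOn_orthonormal_map {A : V → F →L[ℝ] E} {U : Set V} {y : V} (hU : IsOpen U)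
    (hy : y ∈ U) (hA : ContDiffOn ℝ ∞ A U) (hAy : Function.Injective (A y)) {n : ℕ}
    (hn : n ≤ Module.finrank ℝ F) :
    ∃ U' ⊆ U, IsOpen U' ∧ y ∈ U' ∧ ∃ x : Fin n → V → F, (∀ i, ContDiffOn ℝ ∞ (x i) U') ∧
      ∀ z ∈ U', Orthonormal ℝ fun i => A z (x i z) := by
  induction n with
  | zero => exact ⟨U, subset_rfl, hU, hy, Fin.elim0, fun i => i.elim0, fun _ _ => .of_isEmpty _⟩
  | succ n ih =>
    obtain ⟨U₁, hU₁U, hU₁, hy₁, x, hx, hon⟩ := ih (by omega)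
    obtain ⟨U₂, hU₂U₁, hU₂, hy₂, ν, hν, hon'⟩ :=
      exists_contDiffOn_orthonormal_vecCons hU₁ hy₁ (hA.mono hU₁U) hAy hx hon hn
    refine ⟨U₂, hU₂U₁.trans hU₁U, hU₂, hy₂, Matrix.vecCons ν x,
      Fin.cases hν fun i => (hx i).mono hU₂U₁, fun z hz => ?_⟩
    convert hon' z hz using 1
    funext i
    cases i using Fin.cases <;> rfl

end SmoothFrames

section AdaptedFrames

variable {V E : Type*} [NormedAddCommGroup V] [NormedSpace ℝ V]
  [NormedAddCommGroup E] [InnerProductSpace ℝ E]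

/-- The component of a vector orthogonal to the axis `k`. For a point of the unit cylinder of axis
`k`, this is the unit normal vector of the cylinder. -/
def radialPart (k : E) : E →L[ℝ] E := (ℝ ∙ k)ᗮ.starProjection

theorem inner_radialPart_of_inner_eq_zero {k g : E} (hg : ⟪g, k⟫ = 0) (w : E) :
    ⟪g, radialPart k w⟫ = ⟪g, w⟫ := by
  rw [radialPart, ← Submodule.inner_starProjection_left_eq_right,
    Submodule.starProjection_eq_self_iff.2 (Submodule.mem_orthogonal_singleton_iff_inner_left.2 hg)]

theorem inner_axis_radialPart (k w : E) : ⟪k, radialPart k w⟫ = 0 :=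
  Submodule.mem_orthogonal_singleton_iff_inner_right.1 (Submodule.starProjection_apply_mem _ w)

theorem radialPart_axis (k : E) : radialPart k k = 0 :=
  (Submodule.starProjection_apply_eq_zero_iff _).2
    (Submodule.le_orthogonal_orthogonal _ (Submodule.mem_span_singleton_self k))

theorem radialPart_eq_self {k w : E} (hw : ⟪w, k⟫ = 0) : radialPart k w = w :=
  Submodule.starProjection_eq_self_iff.2 (Submodule.mem_orthogonal_singleton_iff_inner_left.2 hw)

theorem dirDeriv_radialPart (k : E) {X : V → V} {f : V → E} {y : V}
    (hf : DifferentiableAt ℝ f y) :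
    dirDeriv X (fun z => radialPart k (f z)) y = radialPart k (dirDeriv X f y) :=
  DFunLike.congr_fun ((radialPart k).hasFDerivAt.comp y hf.hasFDerivAt).fderiv (X y)

/-- An orthonormal frame adapted to a parametrised surface `f` in the unit cylinder of axis `k`,
where `k = σ • T + c • ξ` with `T` tangent and `ξ` normal: `t` and `s` are the tangent fields with
`f_* t = T` and `f_* s ⊥ T`, while `W = c • T - σ • ξ` is the direction of the part of `T` tangent
to the sphere, and `η` is the second normal field. -/
structure AdaptedFrame (k : E) (σ c : ℝ) (f : V → E) (U : Set V) where
  t : V → V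
  s : V → V
  W : V → E
  η : V → E
  isOpen : IsOpen U
  sq_add_sq : σ ^ 2 + c ^ 2 = 1
  contDiffOn_f : ContDiffOn ℝ ∞ f U
  contDiffOn_t : ContDiffOn ℝ ∞ t U
  contDiffOn_s : ContDiffOn ℝ ∞ s U
  contDiffOn_W : ContDiffOn ℝ ∞ W U
  contDiffOn_η : ContDiffOn ℝ ∞ η U
  dirDeriv_t : ∀ y ∈ U, dirDeriv t f y = c • W y + σ • k
  orthonormal : ∀ y ∈ U, Orthonormal ℝ ![η y, radialPart k (f y), W y, dirDeriv s f y, k]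

namespace AdaptedFrame

variable {k : E} {σ c : ℝ} {f : V → E} {U : Set V} (A : AdaptedFrame k σ c f U) {y : V}

/-- The unit tangent field orthogonal to the tangential part of the axis. -/
def S : V → E := dirDeriv A.s f

/-- The unit normal field of the cylinder along the surface. -/
def N (_ : AdaptedFrame k σ c f U) (y : V) : E := radialPart k (f y)

/-- The quotient `⟪η, II(T, T)⟫ / c`, where `II` is the second fundamental form. -/
def a (y : V) : ℝ := ⟪A.η y, dirDeriv A.t A.W y⟫

/-- The quotient `⟪η, II(T, S)⟫ / c`, where `II` is the second fundamental form. -/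
def b (y : V) : ℝ := ⟪A.η y, dirDeriv A.s A.W y⟫

/-- The quotient `⟪ξ, II(S, S)⟫ / σ`, where `II` is the second fundamental form and
`ξ = c • k - σ • W`. -/
def l (y : V) : ℝ := ⟪A.S y, dirDeriv A.s A.W y⟫

/-- The trace of the second fundamental form in the normal direction `η`. -/
def m (y : V) : ℝ := c * A.a y + ⟪A.η y, dirDeriv A.s A.S y⟫

theorem contDiffOn_S : ContDiffOn ℝ ∞ A.S U :=
  contDiffOn_dirDeriv A.isOpen A.contDiffOn_s A.contDiffOn_f

theorem contDiffOn_N : ContDiffOn ℝ ∞ A.N U :=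
  (radialPart k).contDiff.comp_contDiffOn A.contDiffOn_f

theorem contDiffOn_a : ContDiffOn ℝ ∞ A.a U :=
  A.contDiffOn_η.inner ℝ (contDiffOn_dirDeriv A.isOpen A.contDiffOn_t A.contDiffOn_W)

theorem contDiffOn_b : ContDiffOn ℝ ∞ A.b U :=
  A.contDiffOn_η.inner ℝ (contDiffOn_dirDeriv A.isOpen A.contDiffOn_s A.contDiffOn_W)

theorem contDiffOn_l : ContDiffOn ℝ ∞ A.l U :=
  A.contDiffOn_S.inner ℝ (contDiffOn_dirDeriv A.isOpen A.contDiffOn_s A.contDiffOn_W)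

theorem contDiffOn_m : ContDiffOn ℝ ∞ A.m U :=
  (contDiffOn_const.mul A.contDiffOn_a).add
    (A.contDiffOn_η.inner ℝ (contDiffOn_dirDeriv A.isOpen A.contDiffOn_s A.contDiffOn_S))

/-- The five fields of the frame, as one family. -/
def frame : Fin 5 → V → E := ![A.η, A.N, A.W, A.S, fun _ => k]

theorem contDiffOn_frame (i : Fin 5) : ContDiffOn ℝ ∞ (A.frame i) U := by
  fin_cases i
  exacts [A.contDiffOn_η, A.contDiffOn_N, A.contDiffOn_W, A.contDiffOn_S, contDiffOn_const]

theorem orthonormal_frame (hy : y ∈ U) : Orthonormal ℝ fun i => A.frame i y := by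
  convert A.orthonormal y hy with i
  fin_cases i <;> rfl

theorem inner_frame (i j : Fin 5) (hy : y ∈ U) :
    ⟪A.frame i y, A.frame j y⟫ = if i = j then 1 else 0 :=
  orthonormal_iff_ite.1 (A.orthonormal_frame hy) i j

theorem inner_frame_dirDeriv_frame (i j : Fin 5) (X : V → V) (hy : y ∈ U) :
    ⟪A.frame i y, dirDeriv X (A.frame j) y⟫ = -⟪A.frame j y, dirDeriv X (A.frame i) y⟫ :=
  inner_dirDeriv_eq_neg_of_inner_eq_const A.isOpen (A.contDiffOn_frame i) (A.contDiffOn_frame j)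
    (fun _ hz => A.inner_frame i j hz) hy

theorem inner_frame_dirDeriv_self (i : Fin 5) (X : V → V) (hy : y ∈ U) :
    ⟪A.frame i y, dirDeriv X (A.frame i) y⟫ = 0 :=
  self_eq_neg.1 (A.inner_frame_dirDeriv_frame i i X hy)

theorem inner_axis_dirDeriv (i : Fin 5) (X : V → V) (hy : y ∈ U) :
    ⟪k, dirDeriv X (A.frame i) y⟫ = 0 := by
  have h := A.inner_frame_dirDeriv_frame 4 i X hy
  rwa [dirDeriv_eq_zero_of_eqOn_const (g := A.frame 4) A.isOpen (v := k) (fun _ _ => rfl) hy,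
    inner_zero_right, neg_zero] at h

theorem dirDeriv_t_N (hy : y ∈ U) : dirDeriv A.t A.N y = c • A.W y := by
  have hf := differentiableAt_of_contDiffOn A.isOpen A.contDiffOn_f hy
  refine (dirDeriv_radialPart k hf).trans ?_
  rw [A.dirDeriv_t y hy, map_add, map_smul, map_smul, radialPart_axis,
    radialPart_eq_self (show ⟪A.W y, k⟫ = 0 from A.inner_frame 2 4 hy), smul_zero, add_zero]

theorem dirDeriv_s_N (hy : y ∈ U) : dirDeriv A.s A.N y = A.S y :=
  (dirDeriv_radialPart k (differentiableAt_of_contDiffOn A.isOpen A.contDiffOn_f hy)).trans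
    (radialPart_eq_self (A.inner_frame 3 4 hy))

theorem inner_N_dirDeriv_t (i : Fin 5) (hy : y ∈ U) :
    ⟪A.N y, dirDeriv A.t (A.frame i) y⟫ = -(c * ⟪A.frame i y, A.W y⟫) := by
  rw [← real_inner_smul_right, ← A.dirDeriv_t_N hy]
  exact A.inner_frame_dirDeriv_frame 1 i A.t hy

theorem inner_N_dirDeriv_s (i : Fin 5) (hy : y ∈ U) :
    ⟪A.N y, dirDeriv A.s (A.frame i) y⟫ = -⟪A.frame i y, A.S y⟫ := by
  rw [← A.dirDeriv_s_N hy]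
  exact A.inner_frame_dirDeriv_frame 1 i A.s hy

theorem orthonormal_fderiv (hy : y ∈ U) :
    Orthonormal ℝ fun i => fderiv ℝ f y (![A.t y, A.s y] i) := by
  have hT : fderiv ℝ f y (A.t y) = c • A.W y + σ • k := A.dirDeriv_t y hy
  have hWW : ⟪A.W y, A.W y⟫ = 1 := A.inner_frame 2 2 hy
  have hWk : ⟪A.W y, k⟫ = 0 := A.inner_frame 2 4 hy
  have hkW : ⟪k, A.W y⟫ = 0 := A.inner_frame 4 2 hy
  have hkk : ⟪k, k⟫ = (1 : ℝ) := A.inner_frame 4 4 hy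
  have hWS : ⟪A.W y, fderiv ℝ f y (A.s y)⟫ = 0 := A.inner_frame 2 3 hy
  have hkS : ⟪k, fderiv ℝ f y (A.s y)⟫ = 0 := A.inner_frame 4 3 hy
  have hSS : ⟪fderiv ℝ f y (A.s y), fderiv ℝ f y (A.s y)⟫ = 1 := A.inner_frame 3 3 hy
  have hTT : ⟪fderiv ℝ f y (A.t y), fderiv ℝ f y (A.t y)⟫ = 1 := by
    simp only [hT, inner_add_left, inner_add_right, real_inner_smul_left, real_inner_smul_right,
      hWW, hWk, hkW, hkk]
    linear_combination A.sq_add_sq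
  have hTS : ⟪fderiv ℝ f y (A.t y), fderiv ℝ f y (A.s y)⟫ = 0 := by
    rw [hT, inner_add_left, real_inner_smul_left, real_inner_smul_left, hWS, hkS]
    ring
  rw [orthonormal_iff_ite, Fin.forall_fin_two, Fin.forall_fin_two, Fin.forall_fin_two]
  exact ⟨⟨hTT, hTS⟩, (real_inner_comm _ _).trans hTS, hSS⟩

theorem fderiv_lieBracket (hy : y ∈ U) :
    fderiv ℝ f y (lieBracket ℝ A.t A.s y) = dirDeriv A.t A.S y - c • dirDeriv A.s A.W y := by
  have hW := differentiableAt_of_contDiffOn A.isOpen A.contDiffOn_W hy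
  rw [← dirDeriv_sub_dirDeriv_eq_fderiv_lieBracket
    ((A.contDiffOn_f.contDiffAt (A.isOpen.mem_nhds hy)).of_le ENat.LEInfty.out)
    (differentiableAt_of_contDiffOn A.isOpen A.contDiffOn_t hy)
    (differentiableAt_of_contDiffOn A.isOpen A.contDiffOn_s hy),
    dirDeriv_congr A.isOpen A.dirDeriv_t hy,
    dirDeriv_add (hW.fun_const_smul c) (differentiableAt_const _), dirDeriv_const_smul c hW,
    dirDeriv_eq_zero_of_eqOn_const A.isOpen (fun _ _ => rfl) hy, add_zero]
  rfl

theorem eq_sum_frame [Fact (Module.finrank ℝ E = 5)] (v : E) (hy : y ∈ U) :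
    v = ⟪A.η y, v⟫ • A.η y + ⟪A.N y, v⟫ • A.N y + ⟪A.W y, v⟫ • A.W y + ⟪A.S y, v⟫ • A.S y +
      ⟪k, v⟫ • k := by
  have hE : Module.finrank ℝ E = 5 := Fact.out
  have : FiniteDimensional ℝ E := Module.finite_of_finrank_pos (by omega)
  have hexp := sum_inner_map_smul_eq_self (.id ℝ E) (A.orthonormal_frame hy)
    (by rw [hE, Fintype.card_fin]) v
  rw [Fin.sum_univ_five] at hexp
  exact hexp.symm

section Tangent

variable [Fact (Module.finrank ℝ V = 2)]

theorem lieBracket_eq (hσ : σ ≠ 0) (hy : y ∈ U) :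
    lieBracket ℝ A.t A.s y = -(c * A.l y) • A.s y := by
  have hV : Module.finrank ℝ V = 2 := Fact.out
  have : FiniteDimensional ℝ V := .of_fact_finrank_eq_two
  have hexp := sum_inner_map_smul_eq_self (fderiv ℝ f y) (A.orthonormal_fderiv hy)
    (by rw [hV, Fintype.card_fin]) (lieBracket ℝ A.t A.s y)
  set α := ⟪fderiv ℝ f y (A.t y), fderiv ℝ f y (lieBracket ℝ A.t A.s y)⟫
  set β := ⟪fderiv ℝ f y (A.s y), fderiv ℝ f y (lieBracket ℝ A.t A.s y)⟫ with hβ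
  have hαβ : α • A.t y + β • A.s y = lieBracket ℝ A.t A.s y := by
    rw [← hexp, Fin.sum_univ_two]; rfl
  have hα : α = 0 := by
    have hk := congrArg (fun v => ⟪k, fderiv ℝ f y v⟫) hαβ
    have hT : fderiv ℝ f y (A.t y) = c • A.W y + σ • k := A.dirDeriv_t y hy
    have hkS : ⟪k, fderiv ℝ f y (A.s y)⟫ = 0 := A.inner_frame 4 3 hy
    have hkW : ⟪k, A.W y⟫ = 0 := A.inner_frame 4 2 hy
    have hkk : ⟪k, k⟫ = (1 : ℝ) := A.inner_frame 4 4 hy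
    have hkDS : ⟪k, dirDeriv A.t A.S y⟫ = 0 := A.inner_axis_dirDeriv 3 A.t hy
    have hkDW : ⟪k, dirDeriv A.s A.W y⟫ = 0 := A.inner_axis_dirDeriv 2 A.s hy
    simp only [map_add, map_smul, hT, A.fderiv_lieBracket hy, inner_add_right, inner_sub_right,
      real_inner_smul_right, hkS, hkW, hkk, hkDS, hkDW] at hk
    simpa [hσ] using hk
  have hβl : β = -(c * A.l y) := by
    rw [hβ, A.fderiv_lieBracket hy, inner_sub_right, real_inner_smul_right]
    change ⟪A.S y, dirDeriv A.t A.S y⟫ - c * A.l y = _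
    rw [show ⟪A.S y, dirDeriv A.t A.S y⟫ = 0 from A.inner_frame_dirDeriv_self 3 A.t hy, zero_sub]
  rw [← hαβ, hα, hβl, zero_smul, zero_add]

theorem dirDeriv_t_S_eq_dirDeriv_s_W (hσ : σ ≠ 0) (hy : y ∈ U) :
    dirDeriv A.t A.S y = c • dirDeriv A.s A.W y - (c * A.l y) • A.S y := by
  have hbracket := A.fderiv_lieBracket hy
  rw [A.lieBracket_eq hσ hy, map_smul, neg_smul] at hbracket
  rw [sub_eq_add_neg]
  exact sub_eq_iff_eq_add'.1 hbracket.symm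

theorem inner_W_dirDeriv_t_S (hσ : σ ≠ 0) (hy : y ∈ U) : ⟪A.W y, dirDeriv A.t A.S y⟫ = 0 := by
  have hWW : ⟪A.W y, dirDeriv A.s A.W y⟫ = 0 := A.inner_frame_dirDeriv_self 2 A.s hy
  have hWS : ⟪A.W y, A.S y⟫ = 0 := A.inner_frame 2 3 hy
  rw [A.dirDeriv_t_S_eq_dirDeriv_s_W hσ hy, inner_sub_right, real_inner_smul_right,
    real_inner_smul_right, hWW, hWS]
  ring

theorem inner_η_dirDeriv_t_S (hσ : σ ≠ 0) (hy : y ∈ U) :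
    ⟪A.η y, dirDeriv A.t A.S y⟫ = c * A.b y := by
  have hηS : ⟪A.η y, A.S y⟫ = 0 := A.inner_frame 0 3 hy
  rw [A.dirDeriv_t_S_eq_dirDeriv_s_W hσ hy, inner_sub_right, real_inner_smul_right,
    real_inner_smul_right, hηS, mul_zero, sub_zero, b]

theorem codazzi (hσ : σ ≠ 0) {g h : V → E} (hg : ContDiffOn ℝ ∞ g U) (hh : ContDiffOn ℝ ∞ h U)
    (hy : y ∈ U) :
    dirDeriv A.t (fun z => ⟪g z, dirDeriv A.s h z⟫) y -
        dirDeriv A.s (fun z => ⟪g z, dirDeriv A.t h z⟫) y =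
      ⟪dirDeriv A.t g y, dirDeriv A.s h y⟫ - ⟪dirDeriv A.s g y, dirDeriv A.t h y⟫ -
        c * A.l y * ⟪g y, dirDeriv A.s h y⟫ := by
  rw [dirDeriv_inner_dirDeriv_sub (differentiableAt_of_contDiffOn A.isOpen hg hy)
    ((hh.contDiffAt (A.isOpen.mem_nhds hy)).of_le ENat.LEInfty.out)
    (differentiableAt_of_contDiffOn A.isOpen A.contDiffOn_t hy)
    (differentiableAt_of_contDiffOn A.isOpen A.contDiffOn_s hy), A.lieBracket_eq hσ hy, map_smul,
    real_inner_smul_right]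
  simp only [dirDeriv]
  ring

variable [Fact (Module.finrank ℝ E = 5)]

theorem dirDeriv_t_W (hσ : σ ≠ 0) (hy : y ∈ U) :
    dirDeriv A.t A.W y = A.a y • A.η y - c • A.N y := by
  have hN : ⟪A.N y, dirDeriv A.t A.W y⟫ = -(c * ⟪A.W y, A.W y⟫) := A.inner_N_dirDeriv_t 2 hy
  have hW : ⟪A.W y, dirDeriv A.t A.W y⟫ = 0 := A.inner_frame_dirDeriv_self 2 A.t hy
  have hS : ⟪A.S y, dirDeriv A.t A.W y⟫ = -⟪A.W y, dirDeriv A.t A.S y⟫ :=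
    A.inner_frame_dirDeriv_frame 3 2 A.t hy
  have hk : ⟪k, dirDeriv A.t A.W y⟫ = 0 := A.inner_axis_dirDeriv 2 A.t hy
  have hWW : ⟪A.W y, A.W y⟫ = 1 := A.inner_frame 2 2 hy
  rw [A.eq_sum_frame (dirDeriv A.t A.W y) hy, hN, hW, hS, A.inner_W_dirDeriv_t_S hσ hy, hk, hWW,
    ← a]
  module

theorem dirDeriv_t_S (hσ : σ ≠ 0) (hy : y ∈ U) :
    dirDeriv A.t A.S y = (c * A.b y) • A.η y := by
  have hN : ⟪A.N y, dirDeriv A.t A.S y⟫ = -(c * ⟪A.S y, A.W y⟫) := A.inner_N_dirDeriv_t 3 hy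
  have hS : ⟪A.S y, dirDeriv A.t A.S y⟫ = 0 := A.inner_frame_dirDeriv_self 3 A.t hy
  have hk : ⟪k, dirDeriv A.t A.S y⟫ = 0 := A.inner_axis_dirDeriv 3 A.t hy
  have hSW : ⟪A.S y, A.W y⟫ = 0 := A.inner_frame 3 2 hy
  rw [A.eq_sum_frame (dirDeriv A.t A.S y) hy, hN, hS, A.inner_W_dirDeriv_t_S hσ hy,
    A.inner_η_dirDeriv_t_S hσ hy, hk, hSW]
  module

theorem dirDeriv_t_η (hσ : σ ≠ 0) (hy : y ∈ U) :
    dirDeriv A.t A.η y = -(A.a y • A.W y + (c * A.b y) • A.S y) := by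
  have hN : ⟪A.N y, dirDeriv A.t A.η y⟫ = -(c * ⟪A.η y, A.W y⟫) := A.inner_N_dirDeriv_t 0 hy
  have hη : ⟪A.η y, dirDeriv A.t A.η y⟫ = 0 := A.inner_frame_dirDeriv_self 0 A.t hy
  have hW : ⟪A.W y, dirDeriv A.t A.η y⟫ = -A.a y := A.inner_frame_dirDeriv_frame 2 0 A.t hy
  have hS : ⟪A.S y, dirDeriv A.t A.η y⟫ = -⟪A.η y, dirDeriv A.t A.S y⟫ :=
    A.inner_frame_dirDeriv_frame 3 0 A.t hy
  have hk : ⟪k, dirDeriv A.t A.η y⟫ = 0 := A.inner_axis_dirDeriv 0 A.t hy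
  have hηW : ⟪A.η y, A.W y⟫ = 0 := A.inner_frame 0 2 hy
  rw [A.eq_sum_frame (dirDeriv A.t A.η y) hy, hN, hη, hW, hS, A.inner_η_dirDeriv_t_S hσ hy, hk,
    hηW]
  module

end Tangent

end AdaptedFrame

end AdaptedFrames

section ParallelMeanCurvature

variable {V E : Type*} [NormedAddCommGroup V] [NormedSpace ℝ V]
  [NormedAddCommGroup E] [InnerProductSpace ℝ E]

/-- The normal space at `y` of the parametrised surface `f` in the unit cylinder of axis `k`. -/
def normalSpace (k : E) (f : V → E) (y : V) : Submodule ℝ E :=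
  (ℝ ∙ radialPart k (f y))ᗮ ⊓ (LinearMap.range (fderiv ℝ f y).toLinearMap)ᗮ

/-- `H` is the mean curvature vector field of the parametrised surface `f` in the unit cylinder of
axis `k`, and it is parallel with respect to the normal connection. Parallelism is only required
where `H` is differentiable, since elsewhere `fderiv ℝ H y` is a junk value. -/
structure IsParallelMeanCurvature (k : E) (f H : V → E) (U : Set V) : Prop where
  mem_normalSpace : ∀ y ∈ U, H y ∈ normalSpace k f y
  trace : ∀ y ∈ U, ∀ v : Fin 2 → V, (Orthonormal ℝ fun i => fderiv ℝ f y (v i)) →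
    ∀ w ∈ normalSpace k f y,
      2 * ⟪w, H y⟫ = ∑ i, ⟪w, fderiv ℝ (fderiv ℝ f) y (v i) (v i)⟫
  parallel : ∀ y ∈ U, DifferentiableAt ℝ H y → ∀ w ∈ normalSpace k f y, ∀ u : V,
    ⟪w, fderiv ℝ H y u⟫ = 0

theorem mem_normalSpace_iff {k : E} {f : V → E} {y : V} {w : E} :
    w ∈ normalSpace k f y ↔ ⟪radialPart k (f y), w⟫ = 0 ∧ ∀ u, ⟪fderiv ℝ f y u, w⟫ = 0 := by
  rw [normalSpace, Submodule.mem_inf, Submodule.mem_orthogonal_singleton_iff_inner_right,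
    Submodule.mem_orthogonal]
  simp only [LinearMap.mem_range, forall_exists_index, forall_apply_eq_imp_iff,
    ContinuousLinearMap.coe_coe]

theorem inner_fderiv_fderiv_of_mem_normalSpace {k w : E} {f : V → E} {X : V → V} {y : V}
    (hf : ContDiffAt ℝ 2 f y) (hX : DifferentiableAt ℝ X y) (hw : w ∈ normalSpace k f y) :
    ⟪w, fderiv ℝ (fderiv ℝ f) y (X y) (X y)⟫ = ⟪w, dirDeriv X (dirDeriv X f) y⟫ := by
  have hf' : DifferentiableAt ℝ (fderiv ℝ f) y :=
    (hf.fderiv_right (m := 1) one_add_one_eq_two.le).differentiableAt one_ne_zero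
  have hXX : dirDeriv X (dirDeriv X f) y =
      fderiv ℝ f y (fderiv ℝ X y (X y)) + fderiv ℝ (fderiv ℝ f) y (X y) (X y) :=
    DFunLike.congr_fun (hf'.hasFDerivAt.clm_apply hX.hasFDerivAt).fderiv (X y)
  have htan : ⟪w, fderiv ℝ f y (fderiv ℝ X y (X y))⟫ = 0 :=
    (real_inner_comm _ _).trans ((mem_normalSpace_iff.1 hw).2 _)
  rw [hXX, inner_add_right, htan, zero_add]

theorem IsParallelMeanCurvature.mono {k : E} {f H : V → E} {U U' : Set V}
    (h : IsParallelMeanCurvature k f H U) (hU : U' ⊆ U) : IsParallelMeanCurvature k f H U' :=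
  ⟨fun y hy => h.mem_normalSpace y (hU hy), fun y hy => h.trace y (hU hy),
    fun y hy => h.parallel y (hU hy)⟩

namespace AdaptedFrame

variable {k : E} {σ c : ℝ} {f H : V → E} {U : Set V} (A : AdaptedFrame k σ c f U) {y : V}

/-- The unit normal vector field in the direction of the normal part of the axis. -/
def ξ (y : V) : E := c • k - σ • A.W y

theorem contDiffOn_ξ : ContDiffOn ℝ ∞ A.ξ U :=
  contDiffOn_const.sub (contDiffOn_const.smul A.contDiffOn_W)

theorem dirDeriv_ξ (X : V → V) (hy : y ∈ U) : dirDeriv X A.ξ y = -(σ • dirDeriv X A.W y) := by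
  have hW := differentiableAt_of_contDiffOn A.isOpen A.contDiffOn_W hy
  have h := dirDeriv_add (X := X) (differentiableAt_const (c • k) (x := y))
    (hW.fun_const_smul (-σ))
  rw [dirDeriv_eq_zero_of_eqOn_const A.isOpen (fun _ _ => rfl) hy, dirDeriv_const_smul _ hW,
    zero_add, neg_smul] at h
  simpa only [neg_smul, ← sub_eq_add_neg] using! h

theorem inner_ξ_ξ (hy : y ∈ U) : ⟪A.ξ y, A.ξ y⟫ = 1 := by
  have hWW : ⟪A.W y, A.W y⟫ = 1 := A.inner_frame 2 2 hy
  have hWk : ⟪A.W y, k⟫ = 0 := A.inner_frame 2 4 hy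
  have hkW : ⟪k, A.W y⟫ = 0 := A.inner_frame 4 2 hy
  have hkk : ⟪k, k⟫ = (1 : ℝ) := A.inner_frame 4 4 hy
  simp only [ξ, inner_sub_left, inner_sub_right, real_inner_smul_left, real_inner_smul_right,
    hWW, hWk, hkW, hkk]
  linear_combination A.sq_add_sq

theorem two_mul_inner_meanCurvature (hH : IsParallelMeanCurvature k f H U) {w : E}
    (hw : w ∈ normalSpace k f y) (hy : y ∈ U) :
    2 * ⟪w, H y⟫ = c * ⟪w, dirDeriv A.t A.W y⟫ + ⟪w, dirDeriv A.s A.S y⟫ := by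
  have hf := (A.contDiffOn_f.contDiffAt (A.isOpen.mem_nhds hy)).of_le (m := 2) ENat.LEInfty.out
  have ht := differentiableAt_of_contDiffOn A.isOpen A.contDiffOn_t hy
  have hs := differentiableAt_of_contDiffOn A.isOpen A.contDiffOn_s hy
  have hW := differentiableAt_of_contDiffOn A.isOpen A.contDiffOn_W hy
  have htt : dirDeriv A.t (dirDeriv A.t f) y = c • dirDeriv A.t A.W y := by
    rw [dirDeriv_congr A.isOpen A.dirDeriv_t hy,
      dirDeriv_add (hW.fun_const_smul c) (differentiableAt_const _), dirDeriv_const_smul c hW,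
      dirDeriv_eq_zero_of_eqOn_const A.isOpen (fun _ _ => rfl) hy, add_zero]
  have htrace := hH.trace y hy _ (A.orthonormal_fderiv hy) w hw
  rw [Fin.sum_univ_two] at htrace
  refine htrace.trans (congrArg₂ _ ?_ (inner_fderiv_fderiv_of_mem_normalSpace hf hs hw))
  exact (inner_fderiv_fderiv_of_mem_normalSpace hf ht hw).trans
    (by rw [htt, real_inner_smul_right])

section MeanCurvature

variable [Fact (Module.finrank ℝ V = 2)]

theorem mem_normalSpace {w : E} (hN : ⟪A.N y, w⟫ = 0) (hT : ⟪dirDeriv A.t f y, w⟫ = 0)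
    (hS : ⟪A.S y, w⟫ = 0) (hy : y ∈ U) : w ∈ normalSpace k f y := by
  have hV : Module.finrank ℝ V = 2 := Fact.out
  have : FiniteDimensional ℝ V := .of_fact_finrank_eq_two
  refine mem_normalSpace_iff.2 ⟨hN, fun u => ?_⟩
  rw [← sum_inner_map_smul_eq_self (fderiv ℝ f y) (A.orthonormal_fderiv hy)
    (by rw [hV, Fintype.card_fin]) u, map_sum, sum_inner]
  simp_rw [map_smul, real_inner_smul_left]
  refine Finset.sum_eq_zero fun i _ => mul_eq_zero_of_right _ ?_
  fin_cases i
  exacts [hT, hS]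

theorem η_mem_normalSpace (hy : y ∈ U) : A.η y ∈ normalSpace k f y := by
  have hWη : ⟪A.W y, A.η y⟫ = 0 := A.inner_frame 2 0 hy
  have hkη : ⟪k, A.η y⟫ = 0 := A.inner_frame 4 0 hy
  refine A.mem_normalSpace (A.inner_frame 1 0 hy) ?_ (A.inner_frame 3 0 hy) hy
  rw [A.dirDeriv_t y hy, inner_add_left, real_inner_smul_left, real_inner_smul_left, hWη, hkη]
  ring

theorem ξ_mem_normalSpace (hy : y ∈ U) : A.ξ y ∈ normalSpace k f y := by
  have hWW : ⟪A.W y, A.W y⟫ = 1 := A.inner_frame 2 2 hy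
  have hWk : ⟪A.W y, k⟫ = 0 := A.inner_frame 2 4 hy
  have hkW : ⟪k, A.W y⟫ = 0 := A.inner_frame 4 2 hy
  have hkk : ⟪k, k⟫ = (1 : ℝ) := A.inner_frame 4 4 hy
  have hNW : ⟪A.N y, A.W y⟫ = 0 := A.inner_frame 1 2 hy
  have hNk : ⟪A.N y, k⟫ = 0 := A.inner_frame 1 4 hy
  have hSW : ⟪A.S y, A.W y⟫ = 0 := A.inner_frame 3 2 hy
  have hSk : ⟪A.S y, k⟫ = 0 := A.inner_frame 3 4 hy
  refine A.mem_normalSpace ?_ ?_ ?_ hy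
  · simp only [ξ, inner_sub_right, real_inner_smul_right, hNW, hNk, mul_zero, sub_zero]
  · simp only [ξ, A.dirDeriv_t y hy, inner_add_left, inner_sub_right, real_inner_smul_left,
      real_inner_smul_right, hWW, hWk, hkW, hkk]
    ring
  · simp only [ξ, inner_sub_right, real_inner_smul_right, hSW, hSk, mul_zero, sub_zero]

theorem two_mul_inner_η (hH : IsParallelMeanCurvature k f H U) (hy : y ∈ U) :
    2 * ⟪A.η y, H y⟫ = A.m y :=
  A.two_mul_inner_meanCurvature hH (A.η_mem_normalSpace hy) hy

theorem two_mul_inner_ξ (hH : IsParallelMeanCurvature k f H U) (hy : y ∈ U) :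
    2 * ⟪A.ξ y, H y⟫ = σ * A.l y := by
  have hkt : ⟪k, dirDeriv A.t A.W y⟫ = 0 := A.inner_axis_dirDeriv 2 A.t hy
  have hks : ⟪k, dirDeriv A.s A.S y⟫ = 0 := A.inner_axis_dirDeriv 3 A.s hy
  have hWt : ⟪A.W y, dirDeriv A.t A.W y⟫ = 0 := A.inner_frame_dirDeriv_self 2 A.t hy
  have hWs : ⟪A.W y, dirDeriv A.s A.S y⟫ = -A.l y := A.inner_frame_dirDeriv_frame 2 3 A.s hy
  rw [A.two_mul_inner_meanCurvature hH (A.ξ_mem_normalSpace hy) hy]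
  simp only [ξ, inner_sub_left, real_inner_smul_left, hkt, hks, hWt, hWs]
  ring

variable [Fact (Module.finrank ℝ E = 5)]

theorem two_smul_meanCurvature (hH : IsParallelMeanCurvature k f H U) (hy : y ∈ U) :
    (2 : ℝ) • H y = A.m y • A.η y + (σ * A.l y) • A.ξ y := by
  obtain ⟨hN, htan⟩ := mem_normalSpace_iff.1 (hH.mem_normalSpace y hy)
  have hT : ⟪dirDeriv A.t f y, H y⟫ = 0 := htan (A.t y)
  rw [A.dirDeriv_t y hy, inner_add_left, real_inner_smul_left, real_inner_smul_left] at hT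
  have hξ := A.two_mul_inner_ξ hH hy
  rw [ξ, inner_sub_left, real_inner_smul_left, real_inner_smul_left] at hξ
  have hW : ⟪A.W y, H y⟫ = -(σ ^ 2 * A.l y / 2) := by
    linear_combination c * hT - σ / 2 * hξ - ⟪A.W y, H y⟫ * A.sq_add_sq
  have hk : ⟪k, H y⟫ = c * σ * A.l y / 2 := by
    linear_combination σ * hT + c / 2 * hξ - ⟪k, H y⟫ * A.sq_add_sq
  have hη : ⟪A.η y, H y⟫ = A.m y / 2 := by linear_combination A.two_mul_inner_η hH hy / 2
  rw [A.eq_sum_frame (H y) hy, hη, hW, hk, show ⟪A.N y, H y⟫ = 0 from hN,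
    show ⟪A.S y, H y⟫ = 0 from htan (A.s y), ξ]
  module

theorem contDiffOn_meanCurvature (A : AdaptedFrame k σ c f U)
    (hH : IsParallelMeanCurvature k f H U) :
    ContDiffOn ℝ ∞ H U := by
  have hsmooth : ContDiffOn ℝ ∞
      (fun z => (2⁻¹ : ℝ) • (A.m z • A.η z + (σ * A.l z) • A.ξ z)) U :=
    contDiffOn_const.smul ((A.contDiffOn_m.smul A.contDiffOn_η).add
      ((contDiffOn_const.mul A.contDiffOn_l).smul A.contDiffOn_ξ))
  exact hsmooth.congr fun z hz => by
    rw [← A.two_smul_meanCurvature hH hz, inv_smul_smul₀ two_ne_zero]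

theorem dirDeriv_two_mul_inner (hH : IsParallelMeanCurvature k f H U) {g : V → E}
    (hg : ContDiffOn ℝ ∞ g U) (hgn : ∀ z ∈ U, g z ∈ normalSpace k f z) (X : V → V) (hy : y ∈ U) :
    dirDeriv X (fun z => 2 * ⟪g z, H z⟫) y =
      ⟪dirDeriv X g y, A.m y • A.η y + (σ * A.l y) • A.ξ y⟫ := by
  have hg' := differentiableAt_of_contDiffOn A.isOpen hg hy
  have hH' := differentiableAt_of_contDiffOn A.isOpen (A.contDiffOn_meanCurvature hH) hy
  refine (dirDeriv_const_smul 2 (hg'.inner ℝ hH')).trans ?_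
  rw [dirDeriv_inner hg' hH', show ⟪g y, dirDeriv X H y⟫ = 0 from
    hH.parallel y hy hH' (g y) (hgn y hy) (X y), zero_add, smul_eq_mul,
    ← A.two_smul_meanCurvature hH hy, real_inner_smul_right]

theorem dirDeriv_m (hH : IsParallelMeanCurvature k f H U) (X : V → V) (hy : y ∈ U) :
    dirDeriv X A.m y = σ ^ 2 * (A.l y * ⟪A.η y, dirDeriv X A.W y⟫) := by
  have hη : ⟪A.η y, dirDeriv X A.η y⟫ = 0 := A.inner_frame_dirDeriv_self 0 X hy
  have hk : ⟪k, dirDeriv X A.η y⟫ = 0 := A.inner_axis_dirDeriv 0 X hy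
  have hW : ⟪A.W y, dirDeriv X A.η y⟫ = -⟪A.η y, dirDeriv X A.W y⟫ :=
    A.inner_frame_dirDeriv_frame 2 0 X hy
  rw [← dirDeriv_congr A.isOpen (fun z hz => A.two_mul_inner_η hH hz) hy,
    A.dirDeriv_two_mul_inner hH A.contDiffOn_η (fun z hz => A.η_mem_normalSpace hz) X hy,
    real_inner_comm]
  simp only [ξ, inner_add_left, inner_sub_left, real_inner_smul_left, hη, hk, hW]
  ring

theorem dirDeriv_l (hσ : σ ≠ 0) (hH : IsParallelMeanCurvature k f H U) (X : V → V) (hy : y ∈ U) :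
    dirDeriv X A.l y = -(A.m y * ⟪A.η y, dirDeriv X A.W y⟫) := by
  have hξ : ⟪A.ξ y, dirDeriv X A.ξ y⟫ = 0 := self_eq_neg.1 <|
    inner_dirDeriv_eq_neg_of_inner_eq_const A.isOpen A.contDiffOn_ξ A.contDiffOn_ξ
      (fun _ hz => A.inner_ξ_ξ hz) hy
  have hη : ⟪A.η y, dirDeriv X A.ξ y⟫ = -(σ * ⟪A.η y, dirDeriv X A.W y⟫) := by
    rw [A.dirDeriv_ξ X hy, inner_neg_right, real_inner_smul_right]
  have hσl : σ * dirDeriv X A.l y = dirDeriv X (fun z => 2 * ⟪A.ξ z, H z⟫) y := by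
    rw [dirDeriv_congr A.isOpen (fun z hz => A.two_mul_inner_ξ hH hz) hy]
    exact (dirDeriv_const_smul σ (differentiableAt_of_contDiffOn A.isOpen A.contDiffOn_l hy)).symm
  rw [A.dirDeriv_two_mul_inner hH A.contDiffOn_ξ (fun z hz => A.ξ_mem_normalSpace hz) X hy,
    inner_add_right, real_inner_smul_right, real_inner_smul_right, real_inner_comm (A.η y),
    real_inner_comm (A.ξ y), hη, hξ] at hσl
  refine mul_left_cancel₀ hσ ?_
  linear_combination hσl

end MeanCurvature

end AdaptedFrame

end ParallelMeanCurvature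

section AdaptedFrameGaussCodazzi

variable {V E : Type*} [NormedAddCommGroup V] [NormedSpace ℝ V]
  [NormedAddCommGroup E] [InnerProductSpace ℝ E]
  [Fact (Module.finrank ℝ V = 2)] [Fact (Module.finrank ℝ E = 5)]

namespace AdaptedFrame

variable {k : E} {σ c : ℝ} {f H : V → E} {U : Set V} (A : AdaptedFrame k σ c f U) {y : V}

theorem dirDeriv_t_l (hσ : σ ≠ 0) (hy : y ∈ U) :
    dirDeriv A.t A.l y =
      c * (A.a y ^ 2 + A.b y ^ 2 - 1 - A.l y ^ 2) - A.m y * A.a y := by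
  have hStW : ∀ z ∈ U, ⟪A.S z, dirDeriv A.t A.W z⟫ = 0 := fun z hz => by
    rw [show ⟪A.S z, dirDeriv A.t A.W z⟫ = _ from A.inner_frame_dirDeriv_frame 3 2 A.t hz,
      show A.frame 3 = A.S from rfl, show A.frame 2 = A.W from rfl,
      A.inner_W_dirDeriv_t_S hσ hz, neg_zero]
  have hSs : ⟪A.S y, dirDeriv A.s A.W y⟫ = A.l y := rfl
  have hηs : ⟪A.η y, dirDeriv A.s A.W y⟫ = A.b y := rfl
  have hNS : ⟪A.N y, dirDeriv A.s A.S y⟫ = -⟪A.S y, A.S y⟫ := A.inner_N_dirDeriv_s 3 hy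
  have hSS : ⟪A.S y, A.S y⟫ = 1 := A.inner_frame 3 3 hy
  have h := A.codazzi hσ A.contDiffOn_S A.contDiffOn_W hy
  rw [dirDeriv_eq_zero_of_eqOn_const A.isOpen hStW hy, A.dirDeriv_t_S hσ hy,
    A.dirDeriv_t_W hσ hy, real_inner_comm _ (dirDeriv A.s A.S y)] at h
  simp only [inner_sub_left, real_inner_smul_left, hSs, hηs, hNS, hSS] at h
  rw [m]
  refine ((sub_zero _).symm.trans h).trans ?_
  ring

theorem dirDeriv_t_b_sub (hσ : σ ≠ 0) (hy : y ∈ U) :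
    dirDeriv A.t A.b y - dirDeriv A.s A.a y = -(2 * c * A.l y * A.b y) := by
  have hWW : ⟪A.W y, dirDeriv A.s A.W y⟫ = 0 := A.inner_frame_dirDeriv_self 2 A.s hy
  have hSs : ⟪A.S y, dirDeriv A.s A.W y⟫ = A.l y := rfl
  have hηs : ⟪A.η y, dirDeriv A.s A.W y⟫ = A.b y := rfl
  have hηη : ⟪A.η y, dirDeriv A.s A.η y⟫ = 0 := A.inner_frame_dirDeriv_self 0 A.s hy
  have hNη : ⟪A.N y, dirDeriv A.s A.η y⟫ = -⟪A.η y, A.S y⟫ := A.inner_N_dirDeriv_s 0 hy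
  have hηS : ⟪A.η y, A.S y⟫ = 0 := A.inner_frame 0 3 hy
  have h := A.codazzi hσ A.contDiffOn_η A.contDiffOn_W hy
  rw [A.dirDeriv_t_η hσ hy, A.dirDeriv_t_W hσ hy, real_inner_comm _ (dirDeriv A.s A.η y)] at h
  simp only [inner_neg_left, inner_add_left, inner_sub_left, real_inner_smul_left, hWW, hSs, hηs,
    hηη, hNη, hηS] at h
  refine h.trans ?_
  ring

theorem dirDeriv_t_m_sub (hσ : σ ≠ 0) (hy : y ∈ U) :
    dirDeriv A.t A.m y - c * (dirDeriv A.t A.a y + dirDeriv A.s A.b y) =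
      A.l y * A.a y - c * A.l y * (A.m y - c * A.a y) := by
  have hm := differentiableAt_of_contDiffOn A.isOpen A.contDiffOn_m hy
  have ha := differentiableAt_of_contDiffOn A.isOpen A.contDiffOn_a hy
  have hb := differentiableAt_of_contDiffOn A.isOpen A.contDiffOn_b hy
  have hηsS : ∀ z ∈ U, ⟪A.η z, dirDeriv A.s A.S z⟫ = A.m z + (-c) • A.a z := fun z _ => by
    rw [m, smul_eq_mul]
    ring
  have hηtS : ∀ z ∈ U, ⟪A.η z, dirDeriv A.t A.S z⟫ = c • A.b z :=
    fun z hz => A.inner_η_dirDeriv_t_S hσ hz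
  have hWS : ⟪A.W y, dirDeriv A.s A.S y⟫ = -A.l y := A.inner_frame_dirDeriv_frame 2 3 A.s hy
  have hSS : ⟪A.S y, dirDeriv A.s A.S y⟫ = 0 := A.inner_frame_dirDeriv_self 3 A.s hy
  have hηη : ⟪A.η y, dirDeriv A.s A.η y⟫ = 0 := A.inner_frame_dirDeriv_self 0 A.s hy
  have h := A.codazzi hσ A.contDiffOn_η A.contDiffOn_S hy
  rw [dirDeriv_congr A.isOpen hηsS hy, dirDeriv_congr A.isOpen hηtS hy, hηsS y hy,
    dirDeriv_add hm (ha.fun_const_smul _), dirDeriv_const_smul _ ha, dirDeriv_const_smul _ hb,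
    A.dirDeriv_t_η hσ hy, A.dirDeriv_t_S hσ hy, real_inner_comm _ (dirDeriv A.s A.η y)] at h
  simp only [inner_neg_left, inner_add_left, real_inner_smul_left, hWS, hSS, hηη,
    smul_eq_mul] at h
  linear_combination h

theorem isGaussCodazziSystem (hσ : σ ≠ 0) (hc : c ≠ 0) (hH : IsParallelMeanCurvature k f H U) :
    IsGaussCodazziSystem σ c A.t A.s A.a A.b A.l A.m U where
  isOpen := A.isOpen
  contDiffOn_t := A.contDiffOn_t
  contDiffOn_s := A.contDiffOn_s
  contDiffOn_a := A.contDiffOn_a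
  contDiffOn_b := A.contDiffOn_b
  contDiffOn_l := A.contDiffOn_l
  contDiffOn_m := A.contDiffOn_m
  lieBracket _ hy := A.lieBracket_eq hσ hy
  dirDeriv_t_l _ hy := A.dirDeriv_l hσ hH A.t hy
  dirDeriv_s_l _ hy := A.dirDeriv_l hσ hH A.s hy
  dirDeriv_t_m _ hy := A.dirDeriv_m hH A.t hy
  dirDeriv_s_m _ hy := A.dirDeriv_m hH A.s hy
  dirDeriv_t_b_sub _ hy := A.dirDeriv_t_b_sub hσ hy
  dirDeriv_t_a_add y hy := by
    have htm : dirDeriv A.t A.m y = σ ^ 2 * (A.l y * A.a y) := A.dirDeriv_m hH A.t hy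
    refine mul_left_cancel₀ hc ?_
    linear_combination htm - A.dirDeriv_t_m_sub hσ hy + A.l y * A.a y * A.sq_add_sq
  gauss y hy := by
    have htl : dirDeriv A.t A.l y = -(A.m y * A.a y) := A.dirDeriv_l hσ hH A.t hy
    refine mul_left_cancel₀ hc ?_
    linear_combination htl - A.dirDeriv_t_l hσ hy

theorem meanCurvature_eq_zero (A : AdaptedFrame k σ c f U) (hσ : σ ≠ 0) (hc : c ≠ 0)
    (hH : IsParallelMeanCurvature k f H U) (hy : y ∈ U) : H y = 0 := by
  have hGC := A.isGaussCodazziSystem hσ hc hH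
  have h := A.two_smul_meanCurvature hH hy
  rw [hGC.l_eq_zero hσ hc hy, hGC.m_eq_zero hσ hc hy, mul_zero, zero_smul, zero_smul,
    add_zero] at h
  exact (smul_eq_zero.1 h).resolve_left two_ne_zero

end AdaptedFrame

end AdaptedFrameGaussCodazzi

section ConstantAngle

variable {V E : Type*} [NormedAddCommGroup V] [NormedSpace ℝ V]
  [NormedAddCommGroup E] [InnerProductSpace ℝ E]

/-- `f` is an immersed surface in the unit cylinder with unit axis `k`, whose axis is at every point
`σ • T` plus a normal vector, for some unit tangent vector `T`. -/
structure IsConstantAngleSurface (k : E) (σ : ℝ) (f : V → E) (U : Set V) : Prop where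
  isOpen : IsOpen U
  norm_axis : ‖k‖ = 1
  contDiffOn : ContDiffOn ℝ ∞ f U
  injective_fderiv : ∀ y ∈ U, Function.Injective (fderiv ℝ f y)
  norm_radialPart : ∀ y ∈ U, ‖radialPart k (f y)‖ = 1
  exists_tangent : ∀ y ∈ U, ∃ x, ‖fderiv ℝ f y x‖ = 1 ∧ k - σ • fderiv ℝ f y x ∈ normalSpace k f y

theorem inner_fderiv_axis {k : E} {σ : ℝ} {f : V → E} {y x : V}
    (hx : k - σ • fderiv ℝ f y x ∈ normalSpace k f y) (u : V) :
    ⟪fderiv ℝ f y u, k⟫ = σ * ⟪fderiv ℝ f y u, fderiv ℝ f y x⟫ := by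
  have horth := (mem_normalSpace_iff.1 hx).2 u
  rw [inner_sub_right, real_inner_smul_right] at horth
  exact sub_eq_zero.1 horth

theorem orthonormal_vecCons_sub_smul_axis {N T S k : E} {σ c : ℝ} (hc : c ≠ 0)
    (hσc : σ ^ 2 + c ^ 2 = 1) (hN : ‖N‖ = 1) (hT : ‖T‖ = 1) (hS : ‖S‖ = 1) (hk : ‖k‖ = 1)
    (hNT : ⟪N, T⟫ = 0) (hNS : ⟪N, S⟫ = 0) (hNk : ⟪N, k⟫ = 0) (hTS : ⟪T, S⟫ = 0)
    (hTk : ⟪T, k⟫ = σ) (hSk : ⟪S, k⟫ = 0) :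
    Orthonormal ℝ ![N, c⁻¹ • (T - σ • k), S, k] := by
  have hTT : ⟪T, T⟫ = 1 := by rw [real_inner_self_eq_norm_sq, hT, one_pow]
  have hkk : ⟪k, k⟫ = (1 : ℝ) := by rw [real_inner_self_eq_norm_sq, hk, one_pow]
  have hkT : ⟪k, T⟫ = σ := (real_inner_comm _ _).trans hTk
  have hkS : ⟪k, S⟫ = 0 := (real_inner_comm _ _).trans hSk
  have hW : ‖c⁻¹ • (T - σ • k)‖ = 1 := by
    rw [← pow_eq_one_iff_of_nonneg (norm_nonneg _) two_ne_zero, ← real_inner_self_eq_norm_sq]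
    simp only [real_inner_smul_left, real_inner_smul_right, inner_sub_left, inner_sub_right,
      hTT, hTk, hkT, hkk]
    field_simp
    linear_combination -hσc
  simp only [orthonormal_vecCons_iff, Fin.forall_fin_succ, Matrix.cons_val_zero,
    Matrix.cons_val_succ, inner_sub_left, inner_sub_right, real_inner_smul_left,
    real_inner_smul_right, hN, hW, hS, hk, hNT, hNS, hNk, hTS, hTk, hSk, hkS, hkk]
  simp [Orthonormal]

namespace IsConstantAngleSurface

variable {k : E} {σ c : ℝ} {f : V → E} {U : Set V} {y : V}

theorem inner_radialPart_fderiv (h : IsConstantAngleSurface k σ f U) (hy : y ∈ U) (u : V) :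
    ⟪radialPart k (f y), fderiv ℝ f y u⟫ = 0 := by
  have hf := differentiableAt_of_contDiffOn h.isOpen h.contDiffOn hy
  have hN : ContDiffOn ℝ ∞ (fun z => radialPart k (f z)) U :=
    (radialPart k).contDiff.comp_contDiffOn h.contDiffOn
  have hconst : ∀ z ∈ U, ⟪radialPart k (f z), radialPart k (f z)⟫ = 1 := fun z hz => by
    rw [real_inner_self_eq_norm_sq, h.norm_radialPart z hz, one_pow]
  have horth := self_eq_neg.1
    (inner_dirDeriv_eq_neg_of_inner_eq_const (X := fun _ => u) h.isOpen hN hN hconst hy)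
  rwa [dirDeriv_radialPart k hf, inner_radialPart_of_inner_eq_zero
    ((real_inner_comm _ _).trans (inner_axis_radialPart k (f y)))] at horth

theorem orthonormal_radialPart_axis (h : IsConstantAngleSurface k σ f U) (hc : c ≠ 0)
    (hσc : σ ^ 2 + c ^ 2 = 1) (hy : y ∈ U) {x u : V} (hx : ‖fderiv ℝ f y x‖ = 1)
    (hxk : k - σ • fderiv ℝ f y x ∈ normalSpace k f y) (hu : ‖fderiv ℝ f y u‖ = 1)
    (hux : ⟪fderiv ℝ f y u, fderiv ℝ f y x⟫ = 0) :
    Orthonormal ℝ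
      ![radialPart k (f y), c⁻¹ • (fderiv ℝ f y x - σ • k), fderiv ℝ f y u, k] := by
  have hxk' := inner_fderiv_axis hxk x
  have huk := inner_fderiv_axis hxk u
  rw [real_inner_self_eq_norm_sq, hx, one_pow, mul_one] at hxk'
  rw [hux, mul_zero] at huk
  exact orthonormal_vecCons_sub_smul_axis hc hσc (h.norm_radialPart y hy) hx hu h.norm_axis
    (h.inner_radialPart_fderiv hy x) (h.inner_radialPart_fderiv hy u)
    ((real_inner_comm _ _).trans (inner_axis_radialPart k (f y))) ((real_inner_comm _ _).trans hux)
    hxk' huk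

theorem exists_contDiffOn_tangent [FiniteDimensional ℝ V] (h : IsConstantAngleSurface k σ f U)
    (hσ : σ ≠ 0) (hy : y ∈ U) :
    ∃ U' ⊆ U, IsOpen U' ∧ y ∈ U' ∧ ∃ t : V → V, ContDiffOn ℝ ∞ t U' ∧ ∀ z ∈ U',
      ‖fderiv ℝ f z (t z)‖ = 1 ∧ k - σ • fderiv ℝ f z (t z) ∈ normalSpace k f z := by
  have hf' : ContDiffOn ℝ ∞ (fderiv ℝ f) U := h.contDiffOn.fderiv_of_isOpen h.isOpen le_rfl
  obtain ⟨U', hU'U, hU', hyU', v, hv, hon⟩ := exists_contDiffOn_orthonormal_map h.isOpen hy hf'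
    (h.injective_fderiv y hy) le_rfl
  have hf'U' := hf'.mono hU'U
  let t : V → V := fun z => σ⁻¹ • ∑ i, ⟪fderiv ℝ f z (v i z), k⟫ • v i z
  have ht : ContDiffOn ℝ ∞ t U' := contDiffOn_const.smul <| .sum fun i _ =>
    ((hf'U'.clm_apply (hv i)).inner ℝ contDiffOn_const).smul (hv i)
  refine ⟨U', hU'U, hU', hyU', t, ht, fun z hz => ?_⟩
  obtain ⟨x, hx, hxk⟩ := h.exists_tangent z (hU'U hz)
  have htx : t z = x := by
    simp_rw [t, inner_fderiv_axis hxk, mul_smul, ← Finset.smul_sum]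
    rw [inv_smul_smul₀ hσ,
      sum_inner_map_smul_eq_self (fderiv ℝ f z) (hon z hz) (Fintype.card_fin _)]
  rw [htx]
  exact ⟨hx, hxk⟩

theorem exists_contDiffOn_tangent_pair [Fact (Module.finrank ℝ V = 2)]
    (h : IsConstantAngleSurface k σ f U) (hσ : σ ≠ 0) (hc : c ≠ 0) (hσc : σ ^ 2 + c ^ 2 = 1)
    (hy : y ∈ U) :
    ∃ U' ⊆ U, IsOpen U' ∧ y ∈ U' ∧ ∃ t s : V → V, ContDiffOn ℝ ∞ t U' ∧ ContDiffOn ℝ ∞ s U' ∧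
      ∀ z ∈ U', Orthonormal ℝ
        ![radialPart k (f z), c⁻¹ • (dirDeriv t f z - σ • k), dirDeriv s f z, k] := by
  have hV : Module.finrank ℝ V = 2 := Fact.out
  have : FiniteDimensional ℝ V := .of_fact_finrank_eq_two
  have hf' : ContDiffOn ℝ ∞ (fderiv ℝ f) U := h.contDiffOn.fderiv_of_isOpen h.isOpen le_rfl
  obtain ⟨U₁, hU₁U, hU₁, hy₁, t, ht, htk⟩ := h.exists_contDiffOn_tangent hσ hy
  obtain ⟨U₂, hU₂U₁, hU₂, hy₂, s, hs, hst⟩ :=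
    exists_contDiffOn_orthonormal_vecCons (x := ![t]) hU₁ hy₁ (hf'.mono hU₁U)
      (h.injective_fderiv y hy) (Fin.forall_fin_one.2 ht)
      (fun z hz => orthonormal_iff_ite.2 (by simp [Fin.forall_fin_one, (htk z hz).1]))
      (by omega)
  refine ⟨U₂, hU₂U₁.trans hU₁U, hU₂, hy₂, t, s, ht.mono hU₂U₁, hs, fun z hz => ?_⟩
  obtain ⟨hs1, hst0, -⟩ := orthonormal_vecCons_iff.1 (hst z hz)
  obtain ⟨ht1, htn⟩ := htk z (hU₂U₁ hz)
  exact h.orthonormal_radialPart_axis hc hσc (hU₁U (hU₂U₁ hz)) ht1 htn hs1 (hst0 0)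

theorem exists_adaptedFrame [Fact (Module.finrank ℝ V = 2)] [Fact (Module.finrank ℝ E = 5)]
    (h : IsConstantAngleSurface k σ f U) (hσ : σ ≠ 0) (hc : c ≠ 0) (hσc : σ ^ 2 + c ^ 2 = 1)
    (hy : y ∈ U) : ∃ U' ⊆ U, y ∈ U' ∧ Nonempty (AdaptedFrame k σ c f U') := by
  have hE : Module.finrank ℝ E = 5 := Fact.out
  obtain ⟨U₁, hU₁U, hU₁, hy₁, t, s, ht, hs, hts⟩ :=
    h.exists_contDiffOn_tangent_pair hσ hc hσc hy
  have hf := h.contDiffOn.mono hU₁U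
  let W : V → E := fun z => c⁻¹ • (dirDeriv t f z - σ • k)
  have hW : ContDiffOn ℝ ∞ W U₁ :=
    contDiffOn_const.smul ((contDiffOn_dirDeriv hU₁ ht hf).sub contDiffOn_const)
  let x : Fin 4 → V → E := ![fun z => radialPart k (f z), W, dirDeriv s f, fun _ => k]
  have hx : ∀ i, ContDiffOn ℝ ∞ (x i) U₁ := by
    simp only [Fin.forall_fin_succ, IsEmpty.forall_iff, and_true]
    exact ⟨(radialPart k).contDiff.comp_contDiffOn hf, hW, contDiffOn_dirDeriv hU₁ hs hf,
      contDiffOn_const⟩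
  have hxz : ∀ z, (fun i => x i z) = ![radialPart k (f z), W z, dirDeriv s f z, k] := fun z => by
    ext i
    fin_cases i <;> rfl
  obtain ⟨U₂, hU₂U₁, hU₂, hy₂, η, hη, hηon⟩ :=
    exists_contDiffOn_orthonormal_vecCons (A := fun _ => .id ℝ E) hU₁ hy₁ contDiffOn_const
      Function.injective_id hx (fun z hz => hxz z ▸ hts z hz) (by omega)
  exact ⟨U₂, hU₂U₁.trans hU₁U, hy₂, ⟨{
    t, s, W, η
    isOpen := hU₂
    sq_add_sq := hσc
    contDiffOn_f := hf.mono hU₂U₁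
    contDiffOn_t := ht.mono hU₂U₁
    contDiffOn_s := hs.mono hU₂U₁
    contDiffOn_W := hW.mono hU₂U₁
    contDiffOn_η := hη
    dirDeriv_t := fun z _ => by rw [smul_inv_smul₀ hc, sub_add_cancel]
    orthonormal := fun z hz => hxz z ▸ hηon z hz }⟩⟩

theorem meanCurvature_eq_zero [Fact (Module.finrank ℝ V = 2)] [Fact (Module.finrank ℝ E = 5)]
    {H : V → E} (h : IsConstantAngleSurface k σ f U) (hσ : σ ≠ 0) (hc : c ≠ 0)
    (hσc : σ ^ 2 + c ^ 2 = 1) (hH : IsParallelMeanCurvature k f H U) (hy : y ∈ U) : H y = 0 := by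
  obtain ⟨U', hU'U, hyU', ⟨A⟩⟩ := h.exists_adaptedFrame hσ hc hσc hy
  exact A.meanCurvature_eq_zero hσ hc (hH.mono hU'U) hyU'

end IsConstantAngleSurface

end ConstantAngle

theorem hasFDerivAt_fderiv_apply {V E : Type*} [NormedAddCommGroup V] [NormedSpace ℝ V]
    [NormedAddCommGroup E] [NormedSpace ℝ E] {f : V → E} {x : V} (hf : ContDiffAt ℝ 2 f x) (v : V) :
    HasFDerivAt (fun y => fderiv ℝ f y v) ((fderiv ℝ (fderiv ℝ f) x).flip v) x := by
  have hf' : DifferentiableAt ℝ (fderiv ℝ f) x :=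
    (hf.fderiv_right (m := 1) one_add_one_eq_two.le).differentiableAt one_ne_zero
  simpa using hf'.hasFDerivAt.clm_apply (hasFDerivAt_const v x)

section Charts

variable {V M : Type*} [NormedAddCommGroup V] [NormedSpace ℝ V] [TopologicalSpace M]
  [ChartedSpace V M]

/-- The derivative at `q` of the preferred chart at `p`. -/
def chartDeriv (p q : M) : V →L[ℝ] V := mfderiv 𝓘(ℝ, V) 𝓘(ℝ, V) (extChartAt 𝓘(ℝ, V) p) q

/-- The change of charts from the preferred chart at `q` to the one at `p`. -/
def chartChange (p q : M) (x : V) : V := extChartAt 𝓘(ℝ, V) p ((extChartAt 𝓘(ℝ, V) q).symm x)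

theorem chartChange_apply (p q : M) :
    chartChange p q (extChartAt 𝓘(ℝ, V) q q) = extChartAt 𝓘(ℝ, V) p q := by
  rw [chartChange, extChartAt_to_inv]

theorem eventually_symm_chartChange {p q : M} (hq : q ∈ (extChartAt 𝓘(ℝ, V) p).source) :
    ∀ᶠ x in nhds (extChartAt 𝓘(ℝ, V) q q),
      (extChartAt 𝓘(ℝ, V) p).symm (chartChange p q x) = (extChartAt 𝓘(ℝ, V) q).symm x := by
  have h := (continuousAt_extChartAt_symm (I := 𝓘(ℝ, V)) q).preimage_mem_nhds
    (t := (extChartAt 𝓘(ℝ, V) p).source)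
    (by rw [extChartAt_to_inv]; exact extChartAt_source_mem_nhds' hq)
  filter_upwards [h] with x hx
  exact (extChartAt 𝓘(ℝ, V) p).left_inv hx

section Smooth

variable [IsManifold 𝓘(ℝ, V) 1 M] {p q : M}

theorem mdifferentiableAt_extChartAt_of_mem (hq : q ∈ (extChartAt 𝓘(ℝ, V) p).source) :
    MDifferentiableAt 𝓘(ℝ, V) 𝓘(ℝ, V) (extChartAt 𝓘(ℝ, V) p) q :=
  mdifferentiableAt_extChartAt (by rwa [extChartAt_source] at hq)

theorem bijective_chartDeriv (hq : q ∈ (extChartAt 𝓘(ℝ, V) p).source) :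
    Function.Bijective (chartDeriv p q : V → V) :=
  (isInvertible_mfderiv_extChartAt hq).bijective

theorem fderiv_chartChange (hq : q ∈ (extChartAt 𝓘(ℝ, V) p).source) :
    fderiv ℝ (chartChange p q) (extChartAt 𝓘(ℝ, V) q q) = chartDeriv p q := by
  have h := (mdifferentiableAt_extChartAt_of_mem hq).mfderiv
  rw [ModelWithCorners.range_eq_univ, fderivWithin_univ] at h
  exact h.symm

theorem chartDeriv_self (q : M) : chartDeriv q q = ContinuousLinearMap.id ℝ V := by
  rw [← fderiv_chartChange (mem_extChartAt_source (I := 𝓘(ℝ, V)) q)]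
  have hid : chartChange q q =ᶠ[nhds (extChartAt 𝓘(ℝ, V) q q)] id := by
    filter_upwards [extChartAt_target_mem_nhds (I := 𝓘(ℝ, V)) q] with x hx
    exact (extChartAt 𝓘(ℝ, V) q).right_inv hx
  exact hid.fderiv_eq.trans fderiv_id

theorem mfderiv_eq_fderiv_comp_chartDeriv {E : Type*} [NormedAddCommGroup E] [NormedSpace ℝ E]
    {g : M → E} {g' : V → E} (hq : q ∈ (extChartAt 𝓘(ℝ, V) p).source)
    (hg : ∀ᶠ x in nhds (extChartAt 𝓘(ℝ, V) p q), g ((extChartAt 𝓘(ℝ, V) p).symm x) = g' x)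
    (hg' : DifferentiableAt ℝ g' (extChartAt 𝓘(ℝ, V) p q)) :
    mfderiv 𝓘(ℝ, V) 𝓘(ℝ, E) g q =
      (fderiv ℝ g' (extChartAt 𝓘(ℝ, V) p q)).comp (chartDeriv p q) := by
  have hcomp := hg'.hasFDerivAt.hasMFDerivAt.comp q
    (mdifferentiableAt_extChartAt_of_mem hq).hasMFDerivAt
  have heq : g =ᶠ[nhds q] g' ∘ extChartAt 𝓘(ℝ, V) p := by
    filter_upwards [(continuousAt_extChartAt' hq).eventually hg,
      extChartAt_source_mem_nhds' hq] with x hx hx'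
    rwa [(extChartAt 𝓘(ℝ, V) p).left_inv hx'] at hx
  exact (hcomp.congr_of_eventuallyEq heq).mfderiv

theorem mfderiv_fderiv_extChartAt_apply {E : Type*} [NormedAddCommGroup E] [NormedSpace ℝ E]
    {f : V → E} (hf : ContDiffAt ℝ 2 f (extChartAt 𝓘(ℝ, V) q q)) (u v : V) :
    mfderiv 𝓘(ℝ, V) 𝓘(ℝ, E) (fun x => fderiv ℝ f (extChartAt 𝓘(ℝ, V) q x) v) q u =
      fderiv ℝ (fderiv ℝ f) (extChartAt 𝓘(ℝ, V) q q) u v := by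
  have hq := mem_extChartAt_source (I := 𝓘(ℝ, V)) q
  have hcomp := (hasFDerivAt_fderiv_apply hf v).hasMFDerivAt.comp q
    (mdifferentiableAt_extChartAt_of_mem hq).hasMFDerivAt
  refine (congrArg (fun A => A u) hcomp.mfderiv).trans ?_
  exact congrArg (fun A => fderiv ℝ (fderiv ℝ f) (extChartAt 𝓘(ℝ, V) q q) (A u) v)
    (chartDeriv_self q)

end Smooth

theorem contDiffAt_chartChange {n : ℕ∞ω} [IsManifold 𝓘(ℝ, V) n M] {p q : M}
    (hq : q ∈ (extChartAt 𝓘(ℝ, V) p).source) :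
    ContDiffAt ℝ n (chartChange p q) (extChartAt 𝓘(ℝ, V) q q) := by
  rw [← contMDiffAt_iff_contDiffAt]
  have hp : ContMDiffAt 𝓘(ℝ, V) 𝓘(ℝ, V) n (extChartAt 𝓘(ℝ, V) p)
      ((extChartAt 𝓘(ℝ, V) q).symm (extChartAt 𝓘(ℝ, V) q q)) := by
    rw [extChartAt_to_inv]
    exact contMDiffAt_extChartAt' (by rwa [extChartAt_source] at hq)
  exact hp.comp _ ((contMDiffOn_extChartAt_symm q).contMDiffAt (extChartAt_target_mem_nhds q))

end Charts

section Trace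

variable {ι F E : Type*} [Fintype ι] [DecidableEq ι] [AddCommGroup F] [Module ℝ F]
  [NormedAddCommGroup E] [InnerProductSpace ℝ E]

theorem inv_gram_map_basis (e v : Module.Basis ι ℝ F) (L : F →ₗ[ℝ] E)
    (hv : Orthonormal ℝ fun i => L (v i)) :
    (Matrix.gram ℝ fun i => L (e i))⁻¹ = e.toMatrix v * (e.toMatrix v).transpose := by
  have hgram (b : Module.Basis ι ℝ F) : Matrix.gram ℝ (fun i => L (b i)) =
      LinearMap.toMatrix₂ b b ((innerₗ E).compl₁₂ L L) := by
    ext i j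
    simp
  refine Matrix.inv_eq_left_inv ?_
  rw [Matrix.mul_assoc, mul_eq_one_comm, hgram, LinearMap.toMatrix₂_mul_basis_toMatrix,
    ← hgram, Matrix.gram_eq_one_iff_orthonormal]
  exact hv

theorem sum_inv_gram_mul_eq_sum_orthonormal (e : Module.Basis ι ℝ F) (L : F →ₗ[ℝ] E)
    (B : F →ₗ[ℝ] F →ₗ[ℝ] ℝ) {v : ι → F} (hv : Orthonormal ℝ fun i => L (v i)) :
    ∑ i, ∑ j, (Matrix.gram ℝ fun i => L (e i))⁻¹ i j * B (e i) (e j) = ∑ i, B (v i) (v i) := by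
  have hlin : LinearIndependent ℝ v := .of_comp L hv.linearIndependent
  have hcard : Fintype.card ι = Module.finrank ℝ F := (Module.finrank_eq_card_basis e).symm
  cases isEmpty_or_nonempty ι
  · simp
  obtain ⟨v, rfl⟩ : ∃ b : Module.Basis ι ℝ F, ⇑b = v :=
    ⟨basisOfLinearIndependentOfCardEqFinrank hlin hcard, by simp⟩
  let P := e.toMatrix v
  calc ∑ i, ∑ j, (Matrix.gram ℝ fun i => L (e i))⁻¹ i j * B (e i) (e j)
    _ = (P * P.transpose * (LinearMap.toMatrix₂ e e B).transpose).trace := by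
        simp [inv_gram_map_basis e v L hv, Matrix.trace, Matrix.mul_apply, P]
    _ = (P.transpose * LinearMap.toMatrix₂ e e B * P).trace := by
        rw [← Matrix.trace_transpose, Matrix.transpose_mul, Matrix.transpose_mul,
          Matrix.transpose_transpose, Matrix.transpose_transpose, ← Matrix.mul_assoc,
          Matrix.trace_mul_comm, ← Matrix.mul_assoc]
    _ = ∑ i, B (v i) (v i) := by
        rw [LinearMap.toMatrix₂_mul_basis_toMatrix]
        simp [Matrix.trace]

end Trace

theorem inner_starProjection_of_mem {E : Type*} [NormedAddCommGroup E] [InnerProductSpace ℝ E]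
    {K : Submodule ℝ E} [K.HasOrthogonalProjection] {w : E} (hw : w ∈ K) (v : E) :
    ⟪w, K.starProjection v⟫ = ⟪w, v⟫ := by
  rw [← Submodule.inner_starProjection_left_eq_right, Submodule.starProjection_eq_self_iff.2 hw]

theorem fderiv_fderiv_comp_apply {V V' E : Type*} [NormedAddCommGroup V] [NormedSpace ℝ V]
    [NormedAddCommGroup V'] [NormedSpace ℝ V'] [NormedAddCommGroup E] [NormedSpace ℝ E]
    {f : V' → E} {τ : V → V'} {x : V} (hf : ContDiffAt ℝ 2 f (τ x)) (hτ : ContDiffAt ℝ 2 τ x)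
    (u v : V) :
    fderiv ℝ (fderiv ℝ (f ∘ τ)) x u v =
      fderiv ℝ (fderiv ℝ f) (τ x) (fderiv ℝ τ x u) (fderiv ℝ τ x v) +
        fderiv ℝ f (τ x) (fderiv ℝ (fderiv ℝ τ) x u v) := by
  have hf' : DifferentiableAt ℝ (fderiv ℝ f) (τ x) :=
    (hf.fderiv_right (m := 1) one_add_one_eq_two.le).differentiableAt one_ne_zero
  have hτ' : DifferentiableAt ℝ (fderiv ℝ τ) x :=
    (hτ.fderiv_right (m := 1) one_add_one_eq_two.le).differentiableAt one_ne_zero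
  have hfτ : fderiv ℝ (f ∘ τ) =ᶠ[nhds x] fun y => (fderiv ℝ f (τ y)).comp (fderiv ℝ τ y) := by
    filter_upwards [hτ.continuousAt.eventually (hf.eventually (by simp)), hτ.eventually (by simp)]
      with y hfy hτy
    exact fderiv_comp y (hfy.differentiableAt two_ne_zero) (hτy.differentiableAt two_ne_zero)
  have hcomp := (hf'.hasFDerivAt.comp x (hτ.differentiableAt two_ne_zero).hasFDerivAt).clm_comp
    hτ'.hasFDerivAt
  rw [hfτ.fderiv_eq]
  refine (congrArg (fun A => A u v) hcomp.fderiv).trans ?_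
  simp [add_comm]

namespace S3R

theorem finrank_E5 : Module.finrank ℝ E5 = 5 := by
  rw [(WithLp.linearEquiv 2 ℝ (EuclideanSpace ℝ (Fin 4) × ℝ)).finrank_eq]
  simp

theorem norm_dt : ‖dt‖ = 1 := by
  simp [dt]

theorem radialPart_dt_incl (q : Space) :
    radialPart dt (incl q) = WithLp.toLp 2 ((q.1 : EuclideanSpace ℝ (Fin 4)), (0 : ℝ)) := by
  have hincl : incl q = WithLp.toLp 2 ((q.1 : EuclideanSpace ℝ (Fin 4)), (0 : ℝ)) + q.2 • dt := by
    apply WithLp.ofLp_injective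
    ext1 <;> simp [dt, incl]
  rw [hincl, map_add, map_smul, radialPart_axis, smul_zero, add_zero,
    radialPart_eq_self (by simp [dt, WithLp.prod_inner_apply])]

theorem norm_radialPart_dt_incl (q : Space) : ‖radialPart dt (incl q)‖ = 1 := by
  simp [radialPart_dt_incl]

theorem contMDiff_coe_sphere_three : ContMDiff (𝓡 3) 𝓘(ℝ, EuclideanSpace ℝ (Fin 4)) ∞
    ((↑) : sphere (0 : EuclideanSpace ℝ (Fin 4)) 1 → EuclideanSpace ℝ (Fin 4)) :=
  have : Fact (Module.finrank ℝ (EuclideanSpace ℝ (Fin 4)) = 3 + 1) := ⟨by simp⟩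
  contMDiff_coe_sphere

theorem mfderiv_coe_sphere_three_injective (v : sphere (0 : EuclideanSpace ℝ (Fin 4)) 1) :
    Function.Injective (mfderiv (𝓡 3) 𝓘(ℝ, EuclideanSpace ℝ (Fin 4))
      ((↑) : sphere (0 : EuclideanSpace ℝ (Fin 4)) 1 → EuclideanSpace ℝ (Fin 4)) v) := by
  have : Fact (Module.finrank ℝ (EuclideanSpace ℝ (Fin 4)) = 3 + 1) := ⟨by simp⟩
  have hinj := injective_mvfderiv_subtypeVal_sphere (n := 3) v
  have hcoe := (contMDiff_coe_sphere_three v).mdifferentiableAt (by simp)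
  rw [hcoe.mvfderiv] at hinj
  rwa [hcoe.mfderiv]

theorem contMDiff_incl : ContMDiff ((𝓡 3).prod 𝓘(ℝ, ℝ)) 𝓘(ℝ, E5) ∞ incl :=
  (WithLp.prodContinuousLinearEquiv 2 ℝ (EuclideanSpace ℝ (Fin 4)) ℝ).symm.contDiff.contMDiff.comp
    ((contMDiff_coe_sphere_three.comp contMDiff_fst).prodMk_space contMDiff_snd)

theorem mfderiv_incl_injective (q : Space) :
    Function.Injective (mfderiv ((𝓡 3).prod 𝓘(ℝ, ℝ)) 𝓘(ℝ, E5) incl q) := by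
  let e := (WithLp.prodContinuousLinearEquiv 2 ℝ (EuclideanSpace ℝ (Fin 4)) ℝ).symm
  have hfst := ((contMDiff_coe_sphere_three q.1).mdifferentiableAt (by simp)).hasMFDerivAt.comp q
    (hasMFDerivAt_fst (I := 𝓡 3) (I' := 𝓘(ℝ, ℝ)) q)
  have hsnd := hasMFDerivAt_snd (I := 𝓡 3) (I' := 𝓘(ℝ, ℝ)) q
  have hprod : HasMFDerivAt ((𝓡 3).prod 𝓘(ℝ, ℝ)) 𝓘(ℝ, EuclideanSpace ℝ (Fin 4) × ℝ)
      (fun x : Space => ((x.1 : EuclideanSpace ℝ (Fin 4)), x.2)) q _ :=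
    ⟨hfst.1.prodMk hsnd.1, hfst.2.prodMk hsnd.2⟩
  have hincl : mfderiv ((𝓡 3).prod 𝓘(ℝ, ℝ)) 𝓘(ℝ, E5) incl q = _ :=
    (e.hasFDerivAt.hasMFDerivAt.comp q hprod).mfderiv
  rw [hincl]
  refine e.injective.comp fun u v huv => ?_
  obtain ⟨h₁, h₂⟩ := Prod.ext_iff.1 huv
  exact Prod.ext (mfderiv_coe_sphere_three_injective _ h₁) h₂

variable {M : Type*} [TopologicalSpace M] [ChartedSpace (EuclideanSpace ℝ (Fin 2)) M]
  {F : M → Space}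

/-- The local parametrization of the surface given by the preferred chart at `p`. -/
def localParam (F : M → Space) (p : M) (x : EuclideanSpace ℝ (Fin 2)) : E5 :=
  incl (F ((extChartAt (𝓡 2) p).symm x))

theorem localParam_extChartAt {p q : M} (hq : q ∈ (extChartAt (𝓡 2) p).source) :
    localParam F p (extChartAt (𝓡 2) p q) = incl (F q) := by
  rw [localParam, (extChartAt (𝓡 2) p).left_inv hq]

theorem meanCurvature_mem_normalPlane (F : M → Space) (q : M) :
    meanCurvature F q ∈ normalPlane F q :=
  Submodule.smul_mem _ _ <| Submodule.sum_mem _ fun _ _ => Submodule.sum_mem _ fun _ _ =>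
    Submodule.smul_mem _ _ (Submodule.starProjection_apply_mem _ _)

theorem inner_secondFundamentalForm {q : M} {w : E5} (hw : w ∈ normalPlane F q)
    (u v : EuclideanSpace ℝ (Fin 2)) :
    ⟪w, secondFundamentalForm F q u v⟫ = ⟪w, diff (coordField F q v) q u⟫ := by
  rw [secondFundamentalForm, inner_starProjection_of_mem hw, ambientCov,
    inner_starProjection_of_mem (Submodule.mem_inf.1 hw).1]

theorem HasParallelMeanCurvature.inner_diff_eq_zero (hH : HasParallelMeanCurvature F) {q : M}
    {w : E5} (hw : w ∈ normalPlane F q) (u : EuclideanSpace ℝ (Fin 2)) :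
    ⟪w, diff (meanCurvature F) q u⟫ = 0 := by
  rw [← inner_starProjection_of_mem (Submodule.mem_inf.1 hw).1, ← inner_starProjection_of_mem hw]
  exact (congrArg (⟪w, ·⟫) (hH q u)).trans (inner_zero_right w)

namespace IsSmoothImmersion

theorem contMDiff_incl (hF : IsSmoothImmersion F) :
    ContMDiff (𝓡 2) 𝓘(ℝ, E5) ∞ (fun q => incl (F q)) :=
  S3R.contMDiff_incl.comp hF.contMDiff

theorem diff_injective (hF : IsSmoothImmersion F) (q : M) :
    Function.Injective (diff (fun q => incl (F q)) q) := by
  have h : diff (fun q => incl (F q)) q = _ := mfderiv_comp (g := incl) (f := F) q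
    ((S3R.contMDiff_incl (F q)).mdifferentiableAt (by simp))
    ((hF.contMDiff q).mdifferentiableAt (by simp))
  rw [h]
  exact (mfderiv_incl_injective (F q)).comp (hF.injective_mfderiv q)

variable [IsManifold (𝓡 2) ∞ M] {p q : M}

theorem contDiffOn_localParam (hF : IsSmoothImmersion F) (p : M) :
    ContDiffOn ℝ ∞ (localParam F p) (extChartAt (𝓡 2) p).target := by
  rw [← contMDiffOn_iff_contDiffOn]
  exact hF.contMDiff_incl.comp_contMDiffOn (contMDiffOn_extChartAt_symm p)

theorem contDiffAt_localParam (hF : IsSmoothImmersion F)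
    (hq : q ∈ (extChartAt (𝓡 2) p).source) :
    ContDiffAt ℝ ∞ (localParam F p) (extChartAt (𝓡 2) p q) :=
  (hF.contDiffOn_localParam p).contDiffAt
    ((isOpen_extChartAt_target p).mem_nhds ((extChartAt (𝓡 2) p).map_source hq))

theorem diff_incl (hF : IsSmoothImmersion F) (hq : q ∈ (extChartAt (𝓡 2) p).source) :
    diff (fun q => incl (F q)) q =
      (fderiv ℝ (localParam F p) (extChartAt (𝓡 2) p q)).comp (chartDeriv p q) :=
  mfderiv_eq_fderiv_comp_chartDeriv hq (.of_forall fun _ => rfl)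
    ((hF.contDiffAt_localParam hq).differentiableAt (by simp))

theorem normalSpace_localParam (hF : IsSmoothImmersion F)
    (hq : q ∈ (extChartAt (𝓡 2) p).source) :
    normalSpace dt (localParam F p) (extChartAt (𝓡 2) p q) = normalPlane F q := by
  rw [normalSpace, normalPlane, ambientTangent, tangentPlane, localParam_extChartAt hq,
    radialPart_dt_incl, hF.diff_incl hq, ContinuousLinearMap.toLinearMap_comp,
    LinearMap.range_comp_of_range_eq_top]
  exact LinearMap.range_eq_top.2 (bijective_chartDeriv hq).surjective

theorem fderiv_localParam_injective (hF : IsSmoothImmersion F)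
    (hq : q ∈ (extChartAt (𝓡 2) p).source) :
    Function.Injective (fderiv ℝ (localParam F p) (extChartAt (𝓡 2) p q)) := by
  have h := hF.diff_injective q
  rw [hF.diff_incl hq, ContinuousLinearMap.coe_comp] at h
  exact h.of_comp_right (bijective_chartDeriv hq).surjective

theorem diff_coordField (hF : IsSmoothImmersion F) (q : M) (u v : EuclideanSpace ℝ (Fin 2)) :
    diff (coordField F q v) q u =
      fderiv ℝ (fderiv ℝ (localParam F q)) (extChartAt (𝓡 2) q q) u v :=
  mfderiv_fderiv_extChartAt_apply ((hF.contDiffAt_localParam (mem_extChartAt_source q)).of_le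
    (m := 2) ENat.LEInfty.out) u v

theorem inner_secondFundamentalForm_eq_fderiv_fderiv (hF : IsSmoothImmersion F)
    (hq : q ∈ (extChartAt (𝓡 2) p).source) {w : E5} (hw : w ∈ normalPlane F q)
    (u v : EuclideanSpace ℝ (Fin 2)) :
    ⟪w, secondFundamentalForm F q u v⟫ =
      ⟪w, fderiv ℝ (fderiv ℝ (localParam F p)) (extChartAt (𝓡 2) p q)
        (chartDeriv p q u) (chartDeriv p q v)⟫ := by
  have hchange : localParam F q =ᶠ[nhds (extChartAt (𝓡 2) q q)]
      localParam F p ∘ chartChange p q := by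
    filter_upwards [eventually_symm_chartChange hq] with x hx
    rw [Function.comp_apply, localParam, localParam, hx]
  have hfp := hF.contDiffAt_localParam hq
  rw [← chartChange_apply p q] at hfp
  have htan (x : EuclideanSpace ℝ (Fin 2)) :
      ⟪w, fderiv ℝ (localParam F p) (extChartAt (𝓡 2) p q) x⟫ = 0 := by
    rw [← hF.normalSpace_localParam hq] at hw
    exact (real_inner_comm _ _).trans ((mem_normalSpace_iff.1 hw).2 x)
  rw [inner_secondFundamentalForm hw, hF.diff_coordField, hchange.fderiv.fderiv_eq,
    fderiv_fderiv_comp_apply (hfp.of_le ENat.LEInfty.out)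
      ((contDiffAt_chartChange (n := ∞) hq).of_le ENat.LEInfty.out), inner_add_right,
    fderiv_chartChange hq, chartChange_apply, htan, add_zero]

theorem two_mul_inner_meanCurvature (hF : IsSmoothImmersion F)
    (hq : q ∈ (extChartAt (𝓡 2) p).source) {w : E5} (hw : w ∈ normalPlane F q)
    {v : Fin 2 → EuclideanSpace ℝ (Fin 2)}
    (hv : Orthonormal ℝ fun i => fderiv ℝ (localParam F p) (extChartAt (𝓡 2) p q) (v i)) :
    2 * ⟪w, meanCurvature F q⟫ =
      ∑ i, ⟪w, fderiv ℝ (fderiv ℝ (localParam F p)) (extChartAt (𝓡 2) p q) (v i) (v i)⟫ := by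
  let B := fderiv ℝ (fderiv ℝ (localParam F p)) (extChartAt (𝓡 2) p q)
  obtain ⟨x, rfl⟩ := (bijective_chartDeriv hq).surjective.comp_left v
  have htrace := sum_inv_gram_mul_eq_sum_orthonormal (EuclideanSpace.basisFun (Fin 2) ℝ).toBasis
    (diff (fun q => incl (F q)) q).toLinearMap
    ((B.toLinearMap₁₂.compr₂ (innerₗ E5 w)).compl₁₂ (chartDeriv p q).toLinearMap
      (chartDeriv p q).toLinearMap)
    (v := x) (by rwa [hF.diff_incl hq])
  refine Eq.trans ?_ htrace
  rw [meanCurvature, inner_smul_right, ← mul_assoc, mul_one_div_cancel two_ne_zero, one_mul]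
  simp_rw [inner_sum, inner_smul_right, hF.inner_secondFundamentalForm_eq_fderiv_fderiv hq hw]
  simp only [OrthonormalBasis.coe_toBasis, EuclideanSpace.basisFun_apply,
    LinearMap.compl₁₂_apply, LinearMap.compr₂_apply]
  rfl

theorem isParallelMeanCurvature (hF : IsSmoothImmersion F) (hH : HasParallelMeanCurvature F)
    (p : M) :
    IsParallelMeanCurvature dt (localParam F p)
      (fun x => meanCurvature F ((extChartAt (𝓡 2) p).symm x)) (extChartAt (𝓡 2) p).target where
  mem_normalSpace := (extChartAt (𝓡 2) p).forall_mem_target.2 fun q hq => by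
    rw [hF.normalSpace_localParam hq, (extChartAt (𝓡 2) p).left_inv hq]
    exact meanCurvature_mem_normalPlane F q
  trace := (extChartAt (𝓡 2) p).forall_mem_target.2 fun q hq v hv w hw => by
    rw [hF.normalSpace_localParam hq] at hw
    rw [(extChartAt (𝓡 2) p).left_inv hq]
    exact hF.two_mul_inner_meanCurvature hq hw hv
  parallel := (extChartAt (𝓡 2) p).forall_mem_target.2 fun q hq hd w hw u => by
    obtain ⟨u, rfl⟩ := (bijective_chartDeriv hq).surjective u
    rw [hF.normalSpace_localParam hq] at hw
    have hdiff : diff (meanCurvature F) q = _ :=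
      mfderiv_eq_fderiv_comp_chartDeriv hq (.of_forall fun _ => rfl) hd
    rw [← hH.inner_diff_eq_zero hw u, hdiff]
    rfl

theorem isConstantAngleSurface (hF : IsSmoothImmersion F) {θ : ℝ}
    (hangle : ∀ p, HasAngleAt F θ p) (p : M) :
    IsConstantAngleSurface dt (Real.sin θ) (localParam F p) (extChartAt (𝓡 2) p).target where
  isOpen := isOpen_extChartAt_target p
  norm_axis := norm_dt
  contDiffOn := hF.contDiffOn_localParam p
  injective_fderiv := (extChartAt (𝓡 2) p).forall_mem_target.2 fun _ hq =>
    hF.fderiv_localParam_injective hq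
  norm_radialPart _ _ := norm_radialPart_dt_incl _
  exists_tangent := (extChartAt (𝓡 2) p).forall_mem_target.2 fun q hq => by
    obtain ⟨_, ⟨u, rfl⟩, ξ, hξ, hu, -, hdt⟩ := hangle q
    rw [hF.diff_incl hq] at hu hdt
    refine ⟨chartDeriv p q u, hu, ?_⟩
    have hnormal : dt - Real.sin θ • fderiv ℝ (localParam F p) (extChartAt (𝓡 2) p q)
        (chartDeriv p q u) = Real.cos θ • ξ := sub_eq_of_eq_add' hdt
    rw [hnormal, hF.normalSpace_localParam hq]
    exact Submodule.smul_mem _ _ hξ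

end IsSmoothImmersion

end S3R

end

theorem theorem1_general {M : Type*} [TopologicalSpace M]
    [ChartedSpace (EuclideanSpace ℝ (Fin 2)) M] [IsManifold (𝓡 2) ∞ M] (F : M → S3R.Space)
    (hF : S3R.IsSmoothImmersion F) (θ : ℝ) (hsin : Real.sin θ ≠ 0) (hcos : Real.cos θ ≠ 0)
    (hangle : ∀ p : M, S3R.HasAngleAt F θ p) (hH : S3R.HasParallelMeanCurvature F) :
    ∀ p : M, S3R.meanCurvature F p = 0 := by
  intro p
  have : Fact (Module.finrank ℝ (EuclideanSpace ℝ (Fin 2)) = 2) := ⟨by simp⟩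
  have : Fact (Module.finrank ℝ S3R.E5 = 5) := ⟨S3R.finrank_E5⟩
  have h := (hF.isConstantAngleSurface hangle p).meanCurvature_eq_zero hsin hcos
    (Real.sin_sq_add_cos_sq θ) (hF.isParallelMeanCurvature hH p) (mem_extChartAt_target p)
  rwa [extChartAt_to_inv] at h

theorem theorem1 {M : Type*} [TopologicalSpace M] [ChartedSpace (EuclideanSpace ℝ (Fin 2)) M]
    [IsManifold (𝓡 2) ∞ M] (F : M → S3R.Space) (hF : S3R.IsSmoothImmersion F)
    (θ : ℝ) (hθ0 : 0 < θ) (hθ1 : θ < Real.pi / 2)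
    (hangle : ∀ p : M, S3R.HasAngleAt F θ p)
    (hH : S3R.HasParallelMeanCurvature F) :
    ∀ p : M, S3R.meanCurvature F p = 0 := by
  exact theorem1_general F hF θ (Real.sin_pos_of_pos_of_lt_pi hθ0 (by linarith)).ne'
    (Real.cos_pos_of_mem_Ioo ⟨by linarith, hθ1⟩).ne' hangle hH
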